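/- Let $\mathcal{L}$ be the complex Lie algebra with basis $\{d_m,h_n,c\mid m,n\in\mathbb{Z}\}$ and brackets $$[d_m,d_n]=(m-n)d_{m+n}+(m-n)h_{m+n}+\frac{m^3-m}{12}\,\delta_{m+n,0}\,c,\qquad [d_m,h_n]=-n\,h_{m+n},\qquad [h_m,h_n]=0,\qquad [\mathcal{L},c]=0 .$$ Let $q\in\mathbb{Z}_{\ge 0}\cup\{+\infty\}$ and let $\mathcal{L}_q$ be the Lie subalgebra of $\mathcal{L}$ spanned by $c$, the $d_i$ with $i\ge 0$, and the $h_j$ with $j\ge -q$ (all $h_j$, $j\in\mathbb{Z}$, if $q=+\infty$). For an $\mathcal{L}_q$-module $V$ put $\mathrm{Ind}_q(V)=\mathcal{U}(\mathcal{L})\otimes_{\mathcal{U}(\mathcal{L}_q)}V$, where $\mathcal{U}(\cdot)$ denotes the universal enveloping algebra; $\mathcal{L}$ acts on it by left multiplication. Theorem. Let $V$ be a simple $\mathcal{L}_q$-module, and suppose that there is an integer $k\ge 0$ such that $h_kV\neq 0$, $d_mV=0$ for all integers $m>k+q$ (no condition if $q=+\infty$), and $h_nV=0$ for all integers $n>k$.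 Then $\mathrm{Ind}_q(V)$ is a simple $\mathcal{L}$-module. -/

import Mathlib

open scoped TensorProduct

noncomputable section

attribute [local instance 100] LieRing.ofAssociativeRing

/-- Labels of the basis vectors `d_m`, `h_n` (for integers `m`, `n`) and `c`. -/
inductive HVIndex : Type
  | d (m : ℤ) : HVIndex
  | h (n : ℤ) : HVIndex
  | c : HVIndex

/-- The underlying vector space of the deformed Heisenberg-Virasoro algebra: the free complex
vector space on the `d_m`, the `h_n` and `c`. -/
def DeformedHV : Type := HVIndex →₀ ℂ

namespace DeformedHV

instance : AddCommGroup DeformedHV := inferInstanceAs (AddCommGroup (HVIndex →₀ ℂ))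

instance : Module ℂ DeformedHV := inferInstanceAs (Module ℂ (HVIndex →₀ ℂ))

/-- The standard basis. -/
def basis : Module.Basis HVIndex ℂ DeformedHV :=
  Module.Basis.ofRepr (LinearEquiv.refl ℂ (HVIndex →₀ ℂ))

def d (m : ℤ) : DeformedHV := basis (HVIndex.d m)

def h (n : ℤ) : DeformedHV := basis (HVIndex.h n)

def c : DeformedHV := basis HVIndex.c

/-- The brackets of basis vectors. -/
def basisBracket : HVIndex → HVIndex → DeformedHV
  | HVIndex.d m, HVIndex.d n =>
      ((m : ℂ) - n) • d (m + n) + ((m : ℂ) - n) • h (m + n)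
        + (if m + n = 0 then ((m : ℂ) ^ 3 - m) / 12 else 0) • c
  | HVIndex.d m, HVIndex.h n => (-(n : ℂ)) • h (m + n)
  | HVIndex.h m, HVIndex.d n => (m : ℂ) • h (n + m)
  | _, _ => 0

/-- The bilinear extension of `basisBracket`. -/
def bracketHom : DeformedHV →ₗ[ℂ] DeformedHV →ₗ[ℂ] DeformedHV :=
  basis.constr ℂ fun i => basis.constr ℂ fun j => basisBracket i j

instance : Bracket DeformedHV DeformedHV := ⟨fun x y => bracketHom x y⟩

theorem bracket_def (x y : DeformedHV) : ⁅x, y⁆ = bracketHom x y := rfl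

theorem bracketHom_basis (i j : HVIndex) :
    bracketHom (basis i) (basis j) = basisBracket i j := by
  simp [bracketHom, Module.Basis.constr_basis]

theorem bracket_d_d (m n : ℤ) :
    ⁅d m, d n⁆ = ((m : ℂ) - n) • d (m + n) + ((m : ℂ) - n) • h (m + n)
        + (if m + n = 0 then ((m : ℂ) ^ 3 - m) / 12 else 0) • c :=
  bracketHom_basis _ _

theorem bracket_d_h (m n : ℤ) : ⁅d m, h n⁆ = (-(n : ℂ)) • h (m + n) :=
  bracketHom_basis _ _

theorem bracket_h_d (m n : ℤ) : ⁅h m, d n⁆ = (m : ℂ) • h (n + m) :=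
  bracketHom_basis _ _

theorem bracket_h_h (m n : ℤ) : ⁅h m, h n⁆ = 0 :=
  bracketHom_basis _ _

theorem bracketHom_basis_c (i : HVIndex) : bracketHom (basis i) c = 0 := by
  rw [c, bracketHom_basis]; cases i <;> rfl

theorem bracketHom_c (x : DeformedHV) : bracketHom c x = 0 := by
  have : bracketHom c = 0 := basis.ext fun i => by
    rw [c, bracketHom_basis]; cases i <;> rfl
  rw [this]; rfl

theorem bracketHom_swap (x y : DeformedHV) : bracketHom x y = -bracketHom y x := by
  have : bracketHom = -bracketHom.flip := by
    refine basis.ext fun i => basis.ext fun j => ?_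
    simp only [LinearMap.neg_apply, LinearMap.flip_apply, bracketHom_basis]
    cases i <;> cases j <;> simp only [basisBracket, neg_zero, neg_smul, neg_neg]
    rename_i m n
    rw [add_comm n m]
    by_cases hmn : m + n = 0
    · obtain rfl : n = -m := by omega
      simp only [if_true, hmn]
      push_cast
      module
    · simp only [if_neg hmn]
      module
  exact congrArg (fun f => f x y) this

theorem bracketHom_self (x : DeformedHV) : bracketHom x x = 0 := by
  have h1 : (2 : ℂ) • bracketHom x x = 0 := by
    rw [two_smul]
    exact add_eq_zero_iff_eq_neg.mpr (bracketHom_swap x x)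
  exact (smul_eq_zero.mp h1).resolve_left two_ne_zero

theorem bracketHom_jacobi (x y z : DeformedHV) :
    bracketHom x (bracketHom y z)
      = bracketHom (bracketHom x y) z + bracketHom y (bracketHom x z) := by
  have key : ∀ i j k, bracketHom (basis i) (bracketHom (basis j) (basis k))
      = bracketHom (bracketHom (basis i) (basis j)) (basis k)
        + bracketHom (basis j) (bracketHom (basis i) (basis k)) := by
    intro i j k
    have hd : ∀ m, basis (HVIndex.d m) = d m := fun _ => rfl
    have hh : ∀ m, basis (HVIndex.h m) = h m := fun _ => rfl
    have hc : basis HVIndex.c = c := rfl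
    have dc : ∀ m, bracketHom (d m) c = 0 := fun m => bracketHom_basis_c _
    have hc' : ∀ m, bracketHom (h m) c = 0 := fun m => bracketHom_basis_c _
    have e1 := bracket_d_d
    have e2 := bracket_d_h
    have e3 := bracket_h_d
    have e4 := bracket_h_h
    simp only [bracket_def] at e1 e2 e3 e4
    rcases i with l | l | _ <;> rcases j with m | m | _ <;> rcases k with n | n | _ <;>
      simp only [hd, hh, hc, e1, e2, e3, e4, dc, hc', bracketHom_c, map_add, map_smul, map_zero,
        LinearMap.add_apply, LinearMap.smul_apply, smul_zero, add_zero,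
        LinearMap.zero_apply]
    · rw [show m + (l + n) = l + (m + n) by ring, show l + m + n = l + (m + n) by ring,
        show n + (l + m) = l + (m + n) by ring]
      by_cases hs : l + (m + n) = 0
      · obtain rfl : n = -l - m := by omega
        simp only [hs, if_true]
        push_cast
        module
      · simp only [if_neg hs]
        push_cast
        module
    · rw [show m + (l + n) = l + (m + n) by ring, show l + m + n = l + (m + n) by ring]
      push_cast
      module
    · rw [show l + n + m = l + (n + m) by ring, show n + (l + m) = l + (n + m) by ring]
      push_cast
      module
    · rw [show m + (n + l) = m + n + l by ring, show n + (m + l) = m + n + l by ring]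
      push_cast
      module
  let T1 : DeformedHV →ₗ[ℂ] DeformedHV →ₗ[ℂ] DeformedHV →ₗ[ℂ] DeformedHV :=
    LinearMap.mk₂ ℂ (fun x y => bracketHom x ∘ₗ bracketHom y - bracketHom (bracketHom x y)
        - bracketHom y ∘ₗ bracketHom x)
      (fun a b y => by ext z; simp; abel) (fun r a y => by ext z; simp [smul_sub])
      (fun a b y => by ext z; simp; abel) (fun r a y => by ext z; simp [smul_sub])
  have h0 : T1 = 0 := by
    refine basis.ext fun i => basis.ext fun j => basis.ext fun k => ?_
    simp [T1, key i j k]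
  have h1 : T1 x y z = 0 := by rw [h0]; rfl
  simp only [T1, LinearMap.mk₂_apply, LinearMap.sub_apply, LinearMap.comp_apply] at h1
  rw [sub_sub, sub_eq_zero] at h1
  exact h1

/-- The deformed Heisenberg-Virasoro Lie algebra. -/
instance : LieRing DeformedHV where
  add_lie x y z := by simp [bracket_def]
  lie_add x y z := by simp [bracket_def]
  lie_self x := bracketHom_self x
  leibniz_lie x y z := bracketHom_jacobi x y z

instance : LieAlgebra ℂ DeformedHV where
  lie_smul r x y := by simp [bracket_def]

/-- Spanning set of the subalgebra attached to `q`: all `d_i` with `i ≥ 0`, all `h_j` with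
`j ≥ -q` (all `h_j` if `q = ∞`), and `c`. -/
def positiveGens (q : ℕ∞) : Set DeformedHV :=
  {x | (∃ i : ℕ, x = d i) ∨ (∃ j : ℤ, ((-j).toNat : ℕ∞) ≤ q ∧ x = h j) ∨ x = c}

theorem c_mem_span (q : ℕ∞) : c ∈ Submodule.span ℂ (positiveGens q) :=
  Submodule.subset_span (Or.inr (Or.inr rfl))

theorem d_mem_span (q : ℕ∞) {m : ℤ} (hm : 0 ≤ m) : d m ∈ Submodule.span ℂ (positiveGens q) := by
  lift m to ℕ using hm
  exact Submodule.subset_span (Or.inl ⟨m, rfl⟩)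

theorem h_mem_span (q : ℕ∞) {j : ℤ} (hj : ((-j).toNat : ℕ∞) ≤ q) :
    h j ∈ Submodule.span ℂ (positiveGens q) :=
  Submodule.subset_span (Or.inr (Or.inl ⟨j, hj, rfl⟩))

theorem h_add_mem_span (q : ℕ∞) (i : ℕ) {j : ℤ} (hj : ((-j).toNat : ℕ∞) ≤ q) :
    h (i + j) ∈ Submodule.span ℂ (positiveGens q) :=
  h_mem_span q (le_trans (by norm_cast; omega) hj)

theorem lie_mem_span (q : ℕ∞) {x y : DeformedHV}
    (hx : x ∈ Submodule.span ℂ (positiveGens q)) (hy : y ∈ Submodule.span ℂ (positiveGens q)) :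
    ⁅x, y⁆ ∈ Submodule.span ℂ (positiveGens q) := by
  induction hx, hy using Submodule.span_induction₂ with
  | mem_mem x y hx hy =>
    rcases hx with ⟨i, rfl⟩ | ⟨i, hi, rfl⟩ | rfl
    · rcases hy with ⟨j, rfl⟩ | ⟨j, hj, rfl⟩ | rfl
      · rw [bracket_d_d]
        exact add_mem (add_mem (Submodule.smul_mem _ _ (d_mem_span q (by positivity)))
          (Submodule.smul_mem _ _ (h_add_mem_span q i (by simp))))
          (Submodule.smul_mem _ _ (c_mem_span q))
      · rw [bracket_d_h]
        exact Submodule.smul_mem _ _ (h_add_mem_span q i hj)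
      · rw [bracket_def, d, bracketHom_basis_c]
        exact zero_mem _
    · rcases hy with ⟨j, rfl⟩ | ⟨j, hj, rfl⟩ | rfl
      · rw [bracket_h_d]
        exact Submodule.smul_mem _ _ (h_add_mem_span q j hi)
      · rw [bracket_h_h]
        exact zero_mem _
      · rw [bracket_def, h, bracketHom_basis_c]
        exact zero_mem _
    · rw [bracket_def, bracketHom_c]
      exact zero_mem _
  | zero_left y hy => simp
  | zero_right x hx => simp
  | add_left x y z _ _ _ h1 h2 => rw [add_lie]; exact add_mem h1 h2
  | add_right x y z _ _ _ h1 h2 => rw [lie_add]; exact add_mem h1 h2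
  | smul_left r x y _ _ h1 => rw [smul_lie]; exact Submodule.smul_mem _ _ h1
  | smul_right r x y _ _ h1 => rw [lie_smul]; exact Submodule.smul_mem _ _ h1

/-- The subalgebra `𝓛_q`, spanned by `d_i`, `h_{i-q}` (`i ≥ 0`) and `c`. -/
def positivePart (q : ℕ∞) : LieSubalgebra ℂ DeformedHV :=
  { Submodule.span ℂ (positiveGens q) with
    lie_mem' := fun hx hy => lie_mem_span q hx hy }

/-- `d_m`, for `m ≥ 0`, as an element of `𝓛_q`. -/
def posD (q : ℕ∞) (m : ℕ) : positivePart q :=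
  ⟨d m, d_mem_span q (Int.natCast_nonneg m)⟩

/-- `h_n`, for `n ≥ 0`, as an element of `𝓛_q`. -/
def posH (q : ℕ∞) (n : ℕ) : positivePart q :=
  ⟨h n, h_mem_span q (by simp)⟩

end DeformedHV

section Induction

/-- The action of the universal enveloping algebra `U(K)` on a `K`-module. -/
def envelopingAction (R : Type*) (K : Type*) (V : Type*) [CommRing R] [LieRing K] [LieAlgebra R K]
    [AddCommGroup V] [Module R V] [LieRingModule K V] [LieModule R K V] :
    UniversalEnvelopingAlgebra R K →ₐ[R] Module.End R V :=
  UniversalEnvelopingAlgebra.lift R (LieModule.toEnd R K V)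

/-- The algebra map `U(K) → U(L)` coming from a Lie subalgebra `K` of `L`. -/
def envelopingIncl (R : Type*) {L : Type*} [CommRing R] [LieRing L] [LieAlgebra R L]
    (K : LieSubalgebra R L) :
    UniversalEnvelopingAlgebra R K →ₐ[R] UniversalEnvelopingAlgebra R L :=
  UniversalEnvelopingAlgebra.lift R ((UniversalEnvelopingAlgebra.ι R).comp K.incl)

/-- The relations `(a u) ⊗ v = a ⊗ (u v)`, for `a` in `U(L)`, `u` in `U(K)` and `v` in `V`, that
turn `U(L) ⊗_R V` into `U(L) ⊗_{U(K)} V`. They are stable under left multiplication, so that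
their `U(L)`-span is their additive span. -/
def inducedRelations (R : Type*) {L : Type*} [CommRing R] [LieRing L] [LieAlgebra R L]
    (K : LieSubalgebra R L) (V : Type*)
    [AddCommGroup V] [Module R V] [LieRingModule K V] [LieModule R K V] :
    Submodule (UniversalEnvelopingAlgebra R L) (UniversalEnvelopingAlgebra R L ⊗[R] V) :=
  Submodule.span (UniversalEnvelopingAlgebra R L)
    {x | ∃ (a : UniversalEnvelopingAlgebra R L) (u : UniversalEnvelopingAlgebra R K) (v : V),
      x = (a * envelopingIncl R K u) ⊗ₜ[R] v - a ⊗ₜ[R] (envelopingAction R K V u v)}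

/-- The induced module `U(L) ⊗_{U(K)} V`. -/
def InducedModule (R : Type*) {L : Type*} [CommRing R] [LieRing L] [LieAlgebra R L]
    (K : LieSubalgebra R L) (V : Type*)
    [AddCommGroup V] [Module R V] [LieRingModule K V] [LieModule R K V] : Type _ :=
  (UniversalEnvelopingAlgebra R L ⊗[R] V) ⧸ inducedRelations R K V

namespace InducedModule

variable (R : Type*) {L : Type*} [CommRing R] [LieRing L] [LieAlgebra R L]
  (K : LieSubalgebra R L) (V : Type*)
  [AddCommGroup V] [Module R V] [LieRingModule K V] [LieModule R K V]

instance : AddCommGroup (InducedModule R K V) :=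
  inferInstanceAs
    (AddCommGroup ((UniversalEnvelopingAlgebra R L ⊗[R] V) ⧸ inducedRelations R K V))

instance : Module (UniversalEnvelopingAlgebra R L) (InducedModule R K V) :=
  inferInstanceAs (Module (UniversalEnvelopingAlgebra R L)
    ((UniversalEnvelopingAlgebra R L ⊗[R] V) ⧸ inducedRelations R K V))

instance : Module R (InducedModule R K V) :=
  inferInstanceAs
    (Module R ((UniversalEnvelopingAlgebra R L ⊗[R] V) ⧸ inducedRelations R K V))

instance : IsScalarTower R (UniversalEnvelopingAlgebra R L) (InducedModule R K V) :=
  inferInstanceAs (IsScalarTower R (UniversalEnvelopingAlgebra R L)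
    ((UniversalEnvelopingAlgebra R L ⊗[R] V) ⧸ inducedRelations R K V))

/-- `L` acts on the induced module through left multiplication in `U(L)`. -/
instance : LieRingModule L (InducedModule R K V) where
  bracket x w := UniversalEnvelopingAlgebra.ι R x • w
  add_lie x y w := by simp only [map_add, add_smul]
  lie_add x w w' := smul_add _ w w'
  leibniz_lie x y w := by
    simp only [LieHom.map_lie, LieRing.of_associative_ring_bracket, sub_smul, mul_smul]
    abel

theorem lie_def (x : L) (w : InducedModule R K V) :
    ⁅x, w⁆ = UniversalEnvelopingAlgebra.ι R x • w := rfl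

instance : LieModule R L (InducedModule R K V) where
  smul_lie r x w := by simp only [lie_def, map_smul, smul_assoc]
  lie_smul r x w := by
    simp only [lie_def]
    rw [← algebraMap_smul (UniversalEnvelopingAlgebra R L) r w,
      ← algebraMap_smul (UniversalEnvelopingAlgebra R L) r
        (UniversalEnvelopingAlgebra.ι R x • w), ← mul_smul, ← mul_smul, Algebra.commutes]

end InducedModule

end Induction

end

-- Write `U` for the image of `V` in the induced module and `hSpan U` for the subspace that the
-- `h_n` generate from it. A nonzero submodule is pushed down in two descents, first into `hSpan U`
-- and then into `U`; simplicity of `V` then puts all of `U` in it, and `U` generates.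
--
-- Both descents are instances of one argument, axiomatised by `LadderSystem`. Raising operators
-- `y_i` build a weight filtration from a subspace. Modulo lower weight they commute, and the
-- lowering operator `a_i` acts on products of `y_j` with `j ≤ i` as `c_i g ∂/∂y_i`, where `c_i ≠ 0`
-- and `g` is injective on the bottom subspace. Given a vector with nonzero leading polynomial `f`,
-- let `N` be the largest index occurring in `f` and apply `a_N`: the new leading polynomial is a
-- nonzero derivative of strictly smaller weight. Iteration ends at a nonzero vector of the bottom
-- subspace (`exists_mem_of_eval_add_mem`). Nonvanishing is tracked on formal polynomials, so linear
-- independence of the monomials is never needed.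
--
-- In `ladderD` the bottom is `hSpan U`, with `y_i = d_{-(i+1)}`, `a_i = h_{k+i+1}`; in `ladderH`,
-- for finite `q`, the bottom is `U`, with `y_i = h_{-(q+i+1)}`, `a_i = d_{k+q+i+1}`. In both,
-- `[a_i, y_i]` is a nonzero multiple of `g = h_k`. If `q = ∞` then `hSpan U = U` and the second
-- descent is empty.
--
-- Injectivity of `h_k` on `U` holds because its kernel is an `𝓛_q`-submodule of a simple module
-- (`h_lie_incl_ne_zero`). On `hSpan U` it follows by applying the second descent to the kernel
-- itself (`h_lie_ne_zero_of_mem_hSpan`).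
--
-- The remaining input is that `V` embeds in the induced module (`InducedModule.incl_injective`).
-- This is the part of the Poincaré–Birkhoff–Witt theorem that is required, and is proved by making
-- `L` act on a free model of the induced module.

attribute [local instance] LieRing.ofAssociativeRing

/-! ### Induction in enveloping algebras -/

/-- Induction on the elements of a universal enveloping algebra. -/
@[elab_as_elim]
theorem enveloping_induction {R L : Type*} [CommRing R] [LieRing L] [LieAlgebra R L]
    {P : UniversalEnvelopingAlgebra R L → Prop}
    (algebraMap : ∀ r, P (algebraMap R _ r))
    (ι : ∀ x, P (UniversalEnvelopingAlgebra.ι R x))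
    (add : ∀ a b, P a → P b → P (a + b)) (mul : ∀ a b, P a → P b → P (a * b))
    (u : UniversalEnvelopingAlgebra R L) : P u := by
  let S : Subalgebra R (UniversalEnvelopingAlgebra R L) :=
    { carrier := {a | P a}
      mul_mem' := fun {a b} => mul a b
      add_mem' := fun {a b} => add a b
      algebraMap_mem' := algebraMap }
  let f : L →ₗ⁅R⁆ S :=
    { toFun := fun x => ⟨UniversalEnvelopingAlgebra.ι R x, ι x⟩
      map_add' := fun x y => Subtype.ext (map_add _ x y)
      map_smul' := fun r x => Subtype.ext (map_smul _ r x)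
      map_lie' := fun {x y} =>
        Subtype.ext (LieHom.map_lie (UniversalEnvelopingAlgebra.ι R) x y) }
  -- By the universal property the identity factors through the subalgebra `S`, which is therefore
  -- everything.
  have h : S.val.comp (UniversalEnvelopingAlgebra.lift R f) = AlgHom.id R _ := by
    ext x
    change ((UniversalEnvelopingAlgebra.lift R f (UniversalEnvelopingAlgebra.ι R x) : S) :
      UniversalEnvelopingAlgebra R L) = UniversalEnvelopingAlgebra.ι R x
    rw [UniversalEnvelopingAlgebra.lift_ι_apply]
    rfl
  have hu := AlgHom.congr_fun h u
  rw [AlgHom.id_apply] at hu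
  rw [← hu]
  exact (UniversalEnvelopingAlgebra.lift R f u).2

/-! ### Relative PBW: an action of `L` on polynomials in a complement of `K` with coefficients in
`V` -/

namespace RelativePBW

noncomputable section

set_option linter.unusedSectionVars false

variable {R L V X : Type*} [CommRing R] [LieRing L] [LieAlgebra R L] {K : LieSubalgebra R L}
  [AddCommGroup V] [Module R V] [LieRingModule K V] [LieModule R K V] [LinearOrder X]
  (e : L ≃ₗ[R] K × (X →₀ R))

/-- The basis vector of the complement of `K` with label `i`. -/
def gen (i : X) : L := e.symm (0, Finsupp.single i 1)

/-- Multiplication by the component of `y` in the complement of `K`, in the associated graded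
module. -/
def lead (V : Type*) [AddCommGroup V] [Module R V] :
    L →ₗ[R] (Multiset X →₀ V) →ₗ[R] (Multiset X →₀ V) :=
  Finsupp.linearCombination R (fun i : X => Finsupp.lmapDomain V R (i ::ₘ ·)) ∘ₗ
    LinearMap.snd R K (X →₀ R) ∘ₗ e.toLinearMap

/-- The component of a vector in the span of `K` and the basis vectors with label above `j`. -/
def upper (j : X) : L →ₗ[R] L :=
  (K.toSubmodule.subtype ∘ₗ LinearMap.fst R K (X →₀ R) +
    Finsupp.linearCombination R (fun i : X => if j < i then gen e i else 0) ∘ₗ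
      LinearMap.snd R K (X →₀ R)) ∘ₗ e.toLinearMap

/-- One step of the recursion that defines the lower order terms of the action of `L`. -/
def lowStep (T : L →ₗ[R] (Multiset X →₀ V) →ₗ[R] (Multiset X →₀ V)) (J : Multiset X) :
    L →ₗ[R] V →ₗ[R] (Multiset X →₀ V) :=
  match J.sort with
  | [] => LinearMap.mk₂ R (fun y v => Finsupp.single 0 ⁅(e y).1, v⁆)
      (by simp) (by simp) (by simp) (by simp)
  | j :: l => LinearMap.mk₂ R
      (fun y v => (lead e V + T) (gen e j) (T (upper e j y) (Finsupp.single (l : Multiset X) v)) +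
        (lead e V + T) ⁅upper e j y, gen e j⁆ (Finsupp.single (l : Multiset X) v))
      (by intros; simp only [map_add, add_lie, LinearMap.add_apply]; abel)
      (by intros; simp only [map_smul, smul_lie, LinearMap.smul_apply, smul_add])
      (by intros; simp only [Finsupp.single_add, map_add]; abel)
      (by intros; simp only [← Finsupp.smul_single, map_smul, smul_add])

/-- The lower order terms of the action of `L`, correct in degrees less than `n`. -/
def lowAux (V : Type*) [AddCommGroup V] [Module R V] [LieRingModule K V] [LieModule R K V] :
    ℕ → L →ₗ[R] (Multiset X →₀ V) →ₗ[R] (Multiset X →₀ V)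
  | 0 => 0
  | n + 1 => (Finsupp.lsum R fun J => (lowStep e (lowAux V n) J).flip).flip

/-- The lower order terms of the action of `L`. -/
def low (V : Type*) [AddCommGroup V] [Module R V] [LieRingModule K V] [LieModule R K V] :
    L →ₗ[R] (Multiset X →₀ V) →ₗ[R] (Multiset X →₀ V) :=
  (Finsupp.lsum R fun J =>
    (((lowAux e V (Multiset.card J + 1)).flip ∘ₗ Finsupp.lsingle J :
      V →ₗ[R] L →ₗ[R] (Multiset X →₀ V)))).flip

/-- The action of `L` on the free module that models the induced module. -/
def act (V : Type*) [AddCommGroup V] [Module R V] [LieRingModule K V] [LieModule R K V] :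
    L →ₗ[R] (Multiset X →₀ V) →ₗ[R] (Multiset X →₀ V) := lead e V + low e V

/-- The elements of degree less than `n`. -/
def degLT (R V X : Type*) [CommRing R] [AddCommGroup V] [Module R V] (n : ℕ) :
    Submodule R (Multiset X →₀ V) :=
  Finsupp.supported V R {J | Multiset.card J < n}

section basic

variable {e}

theorem act_apply (y : L) (m : Multiset X →₀ V) : act e V y m = lead e V y m + low e V y m := rfl

theorem single_mem_degLT {n : ℕ} {J : Multiset X} (hJ : Multiset.card J < n) (v : V) :
    Finsupp.single J v ∈ degLT R V X n :=
  Finsupp.single_mem_supported R v hJ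

theorem degLT_mono {m n : ℕ} (h : m ≤ n) : degLT R V X m ≤ degLT R V X n :=
  Finsupp.supported_mono fun _ hJ => lt_of_lt_of_le hJ h

theorem map_mem_of_mem_degLT {N : Type*} [AddCommGroup N] [Module R N] {n : ℕ}
    {f : (Multiset X →₀ V) →ₗ[R] N} {S : Submodule R N}
    (h : ∀ J v, Multiset.card J < n → f (Finsupp.single J v) ∈ S)
    {m : Multiset X →₀ V} (hm : m ∈ degLT R V X n) : f m ∈ S := by
  rw [← Finsupp.sum_single m, Finsupp.sum, map_sum]
  exact sum_mem fun J hJ => h J _ ((Finsupp.mem_supported R m).1 hm hJ)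

theorem map_eq_of_mem_degLT {N : Type*} [AddCommGroup N] [Module R N] {n : ℕ}
    {f g : (Multiset X →₀ V) →ₗ[R] N}
    (h : ∀ J v, Multiset.card J < n → f (Finsupp.single J v) = g (Finsupp.single J v))
    {m : Multiset X →₀ V} (hm : m ∈ degLT R V X n) : f m = g m := by
  rw [← sub_eq_zero, ← LinearMap.sub_apply, ← Submodule.mem_bot R]
  exact map_mem_of_mem_degLT (fun J v hJ => by simp [h J v hJ]) hm

theorem lead_gen (i : X) (J : Multiset X) (v : V) :
    lead e V (gen e i) (Finsupp.single J v) = Finsupp.single (i ::ₘ J) v := by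
  simp [lead, gen]

theorem lead_mem {n : ℕ} (y : L) {m : Multiset X →₀ V} (hm : m ∈ degLT R V X n) :
    lead e V y m ∈ degLT R V X (n + 1) := by
  refine map_mem_of_mem_degLT (fun J v hJ => ?_) hm
  simp only [lead, LinearMap.comp_apply, Finsupp.linearCombination_apply, Finsupp.sum,
    LinearMap.sum_apply, LinearMap.smul_apply, Finsupp.lmapDomain_apply, Finsupp.mapDomain_single]
  exact sum_mem fun i _ => Submodule.smul_mem _ _ (single_mem_degLT (by simpa using hJ) v)

theorem upper_gen_of_lt {i j : X} (h : j < i) : upper e j (gen e i) = gen e i := by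
  simp [upper, gen, h]

theorem upper_gen_of_le {i j : X} (h : i ≤ j) : upper e j (gen e i) = 0 := by
  simp [upper, gen, h.not_gt]

theorem lowAux_succ (n : ℕ) (y : L) (J : Multiset X) (v : V) :
    lowAux e V (n + 1) y (Finsupp.single J v) = lowStep e (lowAux e V n) J y v := by
  simp [lowAux]

theorem low_single (y : L) (J : Multiset X) (v : V) :
    low e V y (Finsupp.single J v) =
      lowAux e V (Multiset.card J + 1) y (Finsupp.single J v) := by
  simp [low]

theorem lowStep_zero (T : L →ₗ[R] (Multiset X →₀ V) →ₗ[R] (Multiset X →₀ V)) (y : L) (v : V) :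
    lowStep e T 0 y v = Finsupp.single 0 ⁅(e y).1, v⁆ := by
  simp only [lowStep, Multiset.sort_zero, LinearMap.mk₂_apply]

theorem lowStep_cons (T : L →ₗ[R] (Multiset X →₀ V) →ₗ[R] (Multiset X →₀ V)) {j : X}
    {J : Multiset X} (hj : ∀ i ∈ J, j ≤ i) (y : L) (v : V) :
    lowStep e T (j ::ₘ J) y v =
      (lead e V + T) (gen e j) (T (upper e j y) (Finsupp.single J v)) +
        (lead e V + T) ⁅upper e j y, gen e j⁆ (Finsupp.single J v) := by
  simp only [lowStep, Multiset.sort_cons _ _ _ hj, LinearMap.mk₂_apply, Multiset.sort_eq]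

theorem exists_min_cons {J : Multiset X} (hJ : J ≠ 0) :
    ∃ j J', J = j ::ₘ J' ∧ ∀ i ∈ J', j ≤ i := by
  have h := Multiset.pairwise_sort J (· ≤ ·)
  have h' := Multiset.sort_eq J (· ≤ ·)
  rcases hl : J.sort (· ≤ ·) with _ | ⟨j, l⟩
  · rw [hl] at h'
    exact absurd h'.symm hJ
  · rw [hl] at h h'
    exact ⟨j, l, h'.symm, by simpa using (List.pairwise_cons.1 h).1⟩

theorem lowAux_mem (n m : ℕ) (y : L) {w : Multiset X →₀ V} (hw : w ∈ degLT R V X m) :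
    lowAux e V n y w ∈ degLT R V X m := by
  induction n generalizing m y w with
  | zero => simp [lowAux]
  | succ n ih =>
    refine map_mem_of_mem_degLT (fun J v hJ => ?_) hw
    rw [lowAux_succ]
    rcases eq_or_ne J 0 with rfl | hJ0
    · rw [lowStep_zero]
      exact single_mem_degLT hJ _
    · obtain ⟨j, J, rfl, hj⟩ := exists_min_cons hJ0
      rw [lowStep_cons _ hj]
      refine degLT_mono (n := m) (m := Multiset.card J + 1 + 1) (by simpa using hJ) ?_
      have hs := single_mem_degLT (R := R) (Nat.lt_succ_self (Multiset.card J)) v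
      have key : ∀ (z : L) {u : Multiset X →₀ V}, u ∈ degLT R V X (Multiset.card J + 1) →
          (lead e V + lowAux e V n) z u ∈ degLT R V X (Multiset.card J + 1 + 1) := fun z u hu =>
        add_mem (lead_mem z hu) (degLT_mono (Nat.le_succ _) (ih _ z hu))
      exact add_mem (key _ (ih _ _ hs)) (key _ hs)

/-- Removing the least label lowers the degree, and lower order terms do not raise it, so each step
of the recursion calls only values already settled. This makes `low` well defined as the stable
value. -/
theorem lowAux_succ_eq (n : ℕ) (y : L) {w : Multiset X →₀ V} (hw : w ∈ degLT R V X n) :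
    lowAux e V (n + 1) y w = lowAux e V n y w := by
  induction n generalizing y w with
  | zero =>
    have : w = 0 := by simpa [degLT] using hw
    simp [this]
  | succ n ih =>
    refine map_eq_of_mem_degLT (fun J v hJ => ?_) hw
    rw [lowAux_succ, lowAux_succ]
    rcases eq_or_ne J 0 with rfl | hJ0
    · rw [lowStep_zero, lowStep_zero]
    · obtain ⟨j, J, rfl, hj⟩ := exists_min_cons hJ0
      have hs : Finsupp.single J v ∈ degLT R V X n := single_mem_degLT (by simpa using hJ) v
      rw [lowStep_cons _ hj, lowStep_cons _ hj]
      simp only [LinearMap.add_apply]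
      rw [ih _ hs, ih _ hs, ih _ (lowAux_mem _ _ _ hs)]

theorem lowAux_eq_of_le {m n : ℕ} (h : m ≤ n) (y : L) {w : Multiset X →₀ V}
    (hw : w ∈ degLT R V X m) : lowAux e V n y w = lowAux e V m y w := by
  induction n, h using Nat.le_induction with
  | base => rfl
  | succ n hn ih => rw [lowAux_succ_eq n y (degLT_mono hn hw), ih]

theorem low_eq (n : ℕ) (y : L) {w : Multiset X →₀ V} (hw : w ∈ degLT R V X n) :
    low e V y w = lowAux e V n y w := by
  refine map_eq_of_mem_degLT (fun J v hJ => ?_) hw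
  rw [low_single, lowAux_eq_of_le hJ y (single_mem_degLT (Nat.lt_succ_self _) v)]

theorem low_mem (n : ℕ) (y : L) {w : Multiset X →₀ V} (hw : w ∈ degLT R V X n) :
    low e V y w ∈ degLT R V X n := by
  rw [low_eq n y hw]
  exact lowAux_mem _ _ _ hw

theorem low_zero (y : L) (v : V) :
    low e V y (Finsupp.single 0 v) = Finsupp.single 0 ⁅(e y).1, v⁆ := by
  rw [low_single, lowAux_succ, lowStep_zero]

/-- The formula is forced by the commutation rule with the least generator `gen e j`. Components of
`y` with label at most `j` need no correction, since prepending them keeps the monomial ordered;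
hence only `upper e j y` appears. -/
theorem low_cons {j : X} {J : Multiset X} (hj : ∀ i ∈ J, j ≤ i) (y : L) (v : V) :
    low e V y (Finsupp.single (j ::ₘ J) v) =
      act e V (gen e j) (low e V (upper e j y) (Finsupp.single J v)) +
        act e V ⁅upper e j y, gen e j⁆ (Finsupp.single J v) := by
  have hs := single_mem_degLT (R := R) (Nat.lt_succ_self (Multiset.card J)) v
  rw [low_single, lowAux_succ, lowStep_cons _ hj, Multiset.card_cons]
  simp only [act, LinearMap.add_apply]
  rw [low_eq _ _ hs, low_eq _ _ hs, low_eq _ _ (lowAux_mem _ _ _ hs)]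

theorem act_gen {j : X} {J : Multiset X} (hj : ∀ i ∈ J, j ≤ i) (v : V) :
    act e V (gen e j) (Finsupp.single J v) = Finsupp.single (j ::ₘ J) v := by
  suffices h : low e V (gen e j) (Finsupp.single J v) = 0 by
    rw [act_apply, h, lead_gen, add_zero]
  rcases eq_or_ne J 0 with rfl | hJ0
  · simp [low_zero, gen]
  · obtain ⟨i, J, rfl, hi⟩ := exists_min_cons hJ0
    rw [low_cons hi, upper_gen_of_le (hj i (by simp))]
    simp

end basic

section coe

variable {e} (he : ∀ κ : K, e κ = (κ, 0))

include he

theorem lead_coe (κ : K) : lead e V κ = 0 := by simp [lead, he]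

theorem upper_coe (j : X) (κ : K) : upper e j κ = κ := by simp [upper, he]

theorem act_coe_zero (κ : K) (v : V) :
    act e V κ (Finsupp.single 0 v) = Finsupp.single 0 ⁅κ, v⁆ := by
  rw [act_apply, lead_coe he, low_zero, he]
  simp

theorem linearMap_ext {N : Type*} [AddCommGroup N] [Module R N] {f g : L →ₗ[R] N}
    (hK : ∀ κ : K, f κ = g κ) (hX : ∀ i, f (gen e i) = g (gen e i)) : f = g := by
  have h : f ∘ₗ e.symm.toLinearMap = g ∘ₗ e.symm.toLinearMap := by
    refine LinearMap.prod_ext (LinearMap.ext fun κ => ?_) (Finsupp.lhom_ext' fun i =>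
      LinearMap.ext_ring (hX i))
    have : e.symm (κ, 0) = κ := by rw [← he, e.symm_apply_apply]
    simpa [this] using hK κ
  ext y
  simpa using LinearMap.congr_fun h (e y)

/-- The elements of the span of `K` and the basis vectors above `j` move past the `j`-th basis
vector. -/
theorem act_act_gen_of_upper {j : X} {J : Multiset X} (hj : ∀ i ∈ J, j ≤ i) (v : V) {u : L}
    (hu : (∃ κ : K, u = κ) ∨ ∃ i, j < i ∧ u = gen e i) :
    act e V u (act e V (gen e j) (Finsupp.single J v)) =
      act e V (gen e j) (act e V u (Finsupp.single J v)) +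
        act e V ⁅u, gen e j⁆ (Finsupp.single J v) := by
  rw [act_gen hj]
  rcases hu with ⟨κ, rfl⟩ | ⟨i, hi, rfl⟩
  · have h : ∀ w : Multiset X →₀ V, act e V κ w = low e V κ w := fun w => by
      rw [act_apply, lead_coe he]
      simp
    rw [h, low_cons hj, upper_coe he, h]
  · have h : ∀ J, act e V (gen e i) (Finsupp.single J v) =
        Finsupp.single (i ::ₘ J) v + low e V (gen e i) (Finsupp.single J v) := fun J => by
      rw [act_apply, lead_gen]
    rw [h, low_cons hj, upper_gen_of_lt hi, h, map_add, act_gen, Multiset.cons_swap, add_assoc]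
    intro a ha
    rcases Multiset.mem_cons.1 ha with rfl | ha
    exacts [hi.le, hj a ha]

/-- Linearity in `u` reduces to `K` and the generators, where the cases above `j` hold by
construction. -/
theorem act_act_gen {j : X} {J : Multiset X} (hj : ∀ i ∈ J, j ≤ i) (v : V) (u : L) :
    act e V u (act e V (gen e j) (Finsupp.single J v)) =
      act e V (gen e j) (act e V u (Finsupp.single J v)) +
        act e V ⁅u, gen e j⁆ (Finsupp.single J v) := by
  have key : (act e V).flip (act e V (gen e j) (Finsupp.single J v)) =
      act e V (gen e j) ∘ₗ (act e V).flip (Finsupp.single J v) -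
        (act e V).flip (Finsupp.single J v) ∘ₗ (LieAlgebra.ad R L (gen e j) : L →ₗ[R] L) := by
    have h : ∀ u : L, act e V ⁅u, gen e j⁆ (Finsupp.single J v) =
        -act e V ⁅gen e j, u⁆ (Finsupp.single J v) := fun u => by
      rw [← lie_skew, map_neg, LinearMap.neg_apply]
    refine linearMap_ext he (fun κ => ?_) fun i => ?_ <;>
      simp only [LinearMap.flip_apply, LinearMap.sub_apply, LinearMap.comp_apply] <;>
      rw [LieAlgebra.ad_apply, sub_eq_add_neg, ← h]
    · exact act_act_gen_of_upper he hj v (Or.inl ⟨κ, rfl⟩)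
    · rcases lt_trichotomy i j with hi | rfl | hi
      -- For `i < j` the roles are exchanged: `i` is also a lower bound of `J`, and `gen e j` lies
      -- above it.
      · have h1 := act_act_gen_of_upper he (J := J) (fun a ha => hi.le.trans (hj a ha)) v
          (u := gen e j) (Or.inr ⟨j, hi, rfl⟩)
        rw [h1, h, add_neg_cancel_right]
      · simp
      · exact act_act_gen_of_upper he hj v (Or.inr ⟨i, hi, rfl⟩)
  have h := LinearMap.congr_fun key u
  simp only [LinearMap.flip_apply, LinearMap.sub_apply, LinearMap.comp_apply,
    LieAlgebra.ad_apply] at h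
  rw [h, sub_eq_add_neg, ← lie_skew u, map_neg, LinearMap.neg_apply]

theorem act_lie_of_forall_gen {m : Multiset X →₀ V} {S : Set L} (hK : ∀ κ : K, (κ : L) ∈ S)
    (hX : ∀ i, gen e i ∈ S)
    (h : ∀ y ∈ S, ∀ z ∈ S, act e V ⁅y, z⁆ m = act e V y (act e V z m) - act e V z (act e V y m))
    (y z : L) : act e V ⁅y, z⁆ m = act e V y (act e V z m) - act e V z (act e V y m) := by
  have ext : ∀ y, (∀ z ∈ S, act e V ⁅y, z⁆ m =
      act e V y (act e V z m) - act e V z (act e V y m)) → ∀ z, act e V ⁅y, z⁆ m =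
      act e V y (act e V z m) - act e V z (act e V y m) := fun y hy => by
    have key : (act e V).flip m ∘ₗ (LieAlgebra.ad R L y : L →ₗ[R] L) =
        act e V y ∘ₗ (act e V).flip m - (act e V).flip (act e V y m) :=
      linearMap_ext he (fun κ => hy κ (hK κ)) fun i => hy _ (hX i)
    exact fun z => LinearMap.congr_fun key z
  refine ext y (fun z hz => ?_) z
  rw [← lie_skew, map_neg, LinearMap.neg_apply, ext z (fun y hy => h z hz y hy) y, neg_sub]

/-- Induction on the degree. If `y` or `z` is a generator at or below every label of the monomial,
the identity is `act_act_gen`. Otherwise both lie above the least label `j`; moving both past `gen e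
j` reduces the claim to smaller degree and the Jacobi identity in `L`. -/
theorem act_lie_single (J : Multiset X) (v : V) (y z : L) :
    act e V ⁅y, z⁆ (Finsupp.single J v) =
      act e V y (act e V z (Finsupp.single J v)) -
        act e V z (act e V y (Finsupp.single J v)) := by
  induction h : Multiset.card J using Nat.strong_induction_on generalizing J v y z with
  | _ n ih =>
  have ih' : ∀ (y z : L) {m : Multiset X →₀ V}, m ∈ degLT R V X n →
      act e V y (act e V z m) = act e V z (act e V y m) + act e V ⁅y, z⁆ m := fun y z m hm =>
    map_eq_of_mem_degLT (f := act e V y ∘ₗ act e V z)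
      (g := act e V z ∘ₗ act e V y + act e V ⁅y, z⁆) (fun J v hJ => by
        simp only [LinearMap.comp_apply, LinearMap.add_apply]
        rw [ih _ hJ J v y z rfl]
        abel) hm
  have left : ∀ {j : X} (_ : ∀ i ∈ J, j ≤ i) (y : L), act e V ⁅y, gen e j⁆ (Finsupp.single J v) =
      act e V y (act e V (gen e j) (Finsupp.single J v)) -
        act e V (gen e j) (act e V y (Finsupp.single J v)) := fun hj y => by
    rw [act_act_gen he hj, add_sub_cancel_left]
  have right : ∀ {j : X} (_ : ∀ i ∈ J, j ≤ i) (y : L),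
      act e V ⁅gen e j, y⁆ (Finsupp.single J v) =
      act e V (gen e j) (act e V y (Finsupp.single J v)) -
        act e V y (act e V (gen e j) (Finsupp.single J v)) := fun hj y => by
    rw [← lie_skew, map_neg, LinearMap.neg_apply, left hj, neg_sub]
  refine act_lie_of_forall_gen he (S := {u | (∃ κ : K, u = κ) ∨ ∃ i, u = gen e i})
    (fun κ => Or.inl ⟨κ, rfl⟩) (fun i => Or.inr ⟨i, rfl⟩) ?_ y z
  rcases eq_or_ne J 0 with rfl | hJ
  · rintro _ (⟨κ, rfl⟩ | ⟨i, rfl⟩) _ (⟨μ, rfl⟩ | ⟨j, rfl⟩)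
    · rw [← LieSubalgebra.coe_bracket]
      simp only [act_coe_zero he, lie_lie, Finsupp.single_sub]
    · exact left (by simp) _
    · exact right (by simp) _
    · exact left (by simp) _
  obtain ⟨j, J, rfl, hj⟩ := exists_min_cons hJ
  have hjn : Multiset.card J < n := by simp [← h]
  have hs : Finsupp.single J v ∈ degLT R V X n := single_mem_degLT hjn v
  -- The image under `z` may have degree `n`, beyond the induction hypothesis. Its leading term, if
  -- any, is a monomial for which `j` is still a lower bound, so `act_act_gen` applies; the rest has
  -- degree less than `n`.
  have comm : ∀ (y : L) {z : L}, ((∃ κ : K, z = κ) ∨ ∃ i, j < i ∧ z = gen e i) →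
      act e V y (act e V (gen e j) (act e V z (Finsupp.single J v))) =
        act e V (gen e j) (act e V y (act e V z (Finsupp.single J v))) +
          act e V ⁅y, gen e j⁆ (act e V z (Finsupp.single J v)) := by
    intro y z hz
    have hlow := ih' y (gen e j) (low_mem (e := e) n z hs)
    rcases hz with ⟨κ, rfl⟩ | ⟨i, hi, rfl⟩
    · rw [act_apply (κ : L), lead_coe he, LinearMap.zero_apply, zero_add, hlow]
    · have hlead := act_act_gen he (j := j) (J := i ::ₘ J)
        (by simpa [hi.le] using hj) v y
      rw [act_apply (gen e i), lead_gen]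
      simp only [map_add]
      rw [hlow, hlead]
      abel
  have main : ∀ {y z : L}, ((∃ κ : K, y = κ) ∨ ∃ i, j < i ∧ y = gen e i) →
      ((∃ κ : K, z = κ) ∨ ∃ i, j < i ∧ z = gen e i) →
      act e V ⁅y, z⁆ (Finsupp.single (j ::ₘ J) v) =
        act e V y (act e V z (Finsupp.single (j ::ₘ J) v)) -
          act e V z (act e V y (Finsupp.single (j ::ₘ J) v)) := by
    intro y z hy hz
    have h8 := ih' y z hs
    have h6 := ih' y ⁅z, gen e j⁆ hs
    have h7 := ih' z ⁅y, gen e j⁆ hs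
    rw [← act_gen (e := e) hj v, act_act_gen he hj, act_act_gen he hj, act_act_gen he hj,
      map_add (act e V y), map_add (act e V z),
      comm y hz, comm z hy, h6, h7, h8, lie_lie, map_sub, map_add, LinearMap.sub_apply]
    abel
  have cases : ∀ {u : L}, ((∃ κ : K, u = κ) ∨ ∃ i, u = gen e i) →
      ((∃ κ : K, u = κ) ∨ ∃ i, j < i ∧ u = gen e i) ∨
        ∃ i, (∀ a ∈ j ::ₘ J, i ≤ a) ∧ u = gen e i := by
    rintro u (⟨κ, rfl⟩ | ⟨i, rfl⟩)
    · exact Or.inl (Or.inl ⟨κ, rfl⟩)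
    · rcases lt_or_ge j i with hi | hi
      · exact Or.inl (Or.inr ⟨i, hi, rfl⟩)
      · refine Or.inr ⟨i, fun a ha => ?_, rfl⟩
        rcases Multiset.mem_cons.1 ha with rfl | ha
        exacts [hi, hi.trans (hj a ha)]
  intro y hy z hz
  rcases cases hy with hy | ⟨i, hi, rfl⟩
  · rcases cases hz with hz | ⟨i, hi, rfl⟩
    · exact main hy hz
    · exact left hi y
  · exact right hi z

/-- The action of `L` on the free module, as a representation. -/
def rep (V : Type*) [AddCommGroup V] [Module R V] [LieRingModule K V] [LieModule R K V] :
    L →ₗ⁅R⁆ Module.End R (Multiset X →₀ V) :=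
  { act e V with
    map_lie' := fun {y z} => by
      refine Finsupp.lhom_ext fun J v => ?_
      simpa [LieRing.of_associative_ring_bracket] using act_lie_single he J v y z }

/-- The degree zero part of the model is a copy of `V` as a `K`-module. This is what makes
`comparison` kill the defining relations. -/
theorem lift_rep_envelopingIncl (u : UniversalEnvelopingAlgebra R K) (v : V) :
    UniversalEnvelopingAlgebra.lift R (rep he V) (envelopingIncl R K u) (Finsupp.single 0 v) =
      Finsupp.single 0 (envelopingAction R K V u v) := by
  induction u using enveloping_induction generalizing v with
  | algebraMap r => simp [Module.algebraMap_end_apply]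
  | ι x =>
    rw [envelopingIncl, envelopingAction, UniversalEnvelopingAlgebra.lift_ι_apply,
      UniversalEnvelopingAlgebra.lift_ι_apply, LieHom.comp_apply,
      UniversalEnvelopingAlgebra.lift_ι_apply]
    exact act_coe_zero he x v
  | add a b ha hb => simp [ha, hb]
  | mul a b ha hb => simp [ha, hb]

/-- The comparison map from `U(L) ⊗ V` to the free module. -/
def comparison (V : Type*) [AddCommGroup V] [Module R V] [LieRingModule K V] [LieModule R K V] :
    UniversalEnvelopingAlgebra R L ⊗[R] V →ₗ[R] (Multiset X →₀ V) :=
  TensorProduct.lift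
    ((UniversalEnvelopingAlgebra.lift R (rep he V)).toLinearMap.compl₂ (Finsupp.lsingle 0))

theorem comparison_tmul (a : UniversalEnvelopingAlgebra R L) (v : V) :
    comparison he V (a ⊗ₜ v) =
      UniversalEnvelopingAlgebra.lift R (rep he V) a (Finsupp.single 0 v) := rfl

theorem comparison_smul (a : UniversalEnvelopingAlgebra R L)
    (t : UniversalEnvelopingAlgebra R L ⊗[R] V) :
    comparison he V (a • t) =
      UniversalEnvelopingAlgebra.lift R (rep he V) a (comparison he V t) := by
  induction t with
  | zero => simp
  | tmul b v => simp [TensorProduct.smul_tmul', comparison_tmul]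
  | add s t hs ht => simp [hs, ht]

theorem comparison_eq_zero {t : UniversalEnvelopingAlgebra R L ⊗[R] V}
    (ht : t ∈ inducedRelations R K V) : comparison he V t = 0 := by
  induction ht using Submodule.span_induction with
  | mem t ht =>
    obtain ⟨a, u, v, rfl⟩ := ht
    simp [comparison_tmul, lift_rep_envelopingIncl]
  | zero => simp
  | add s t _ _ hs ht => simp [hs, ht]
  | smul a t _ ht => simp [comparison_smul, ht]

end coe

end

end RelativePBW

/-! ### The canonical map into the induced module: equivariance, generation, injectivity -/

namespace InducedModule

noncomputable section

variable {R L V : Type*} [CommRing R] [LieRing L] [LieAlgebra R L] {K : LieSubalgebra R L}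
  [AddCommGroup V] [Module R V] [LieRingModule K V] [LieModule R K V]

/-- The canonical map `v ↦ 1 ⊗ v` from a module to its induced module. -/
def incl (R : Type*) {L : Type*} [CommRing R] [LieRing L] [LieAlgebra R L]
    (K : LieSubalgebra R L) (V : Type*)
    [AddCommGroup V] [Module R V] [LieRingModule K V] [LieModule R K V] :
    V →ₗ[R] InducedModule R K V :=
  (inducedRelations R K V).mkQ.restrictScalars R ∘ₗ
    TensorProduct.mk R (UniversalEnvelopingAlgebra R L) V 1

theorem smul_incl (a : UniversalEnvelopingAlgebra R L) (v : V) :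
    a • incl R K V v = (inducedRelations R K V).mkQ (a ⊗ₜ v) := by
  change a • (inducedRelations R K V).mkQ (1 ⊗ₜ v) = _
  rw [← map_smul, TensorProduct.smul_tmul', smul_eq_mul, mul_one]

theorem incl_lie (κ : K) (v : V) : incl R K V ⁅κ, v⁆ = ⁅(κ : L), incl R K V v⁆ := by
  have h : (1 * envelopingIncl R K (UniversalEnvelopingAlgebra.ι R κ)) ⊗ₜ[R] v -
      1 ⊗ₜ[R] envelopingAction R K V (UniversalEnvelopingAlgebra.ι R κ) v ∈
      inducedRelations R K V := Submodule.subset_span ⟨1, _, v, rfl⟩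
  rw [envelopingIncl, envelopingAction, UniversalEnvelopingAlgebra.lift_ι_apply,
    UniversalEnvelopingAlgebra.lift_ι_apply, one_mul] at h
  rw [lie_def, smul_incl]
  exact ((Submodule.Quotient.eq _).2 h).symm

theorem smul_mem_of_mem (N : LieSubmodule R L (InducedModule R K V))
    (a : UniversalEnvelopingAlgebra R L) {w : InducedModule R K V} (hw : w ∈ N) : a • w ∈ N := by
  induction a using enveloping_induction generalizing w with
  | algebraMap r => rw [algebraMap_smul]; exact N.smul_mem r hw
  | ι x => exact N.lie_mem hw
  | add a b ha hb => rw [add_smul]; exact N.add_mem (ha hw) (hb hw)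
  | mul a b ha hb => rw [mul_smul]; exact ha (hb hw)

/-- The induced module is generated by the image of the canonical map. -/
theorem eq_top_of_incl_mem {N : LieSubmodule R L (InducedModule R K V)}
    (h : ∀ v, incl R K V v ∈ N) : N = ⊤ := by
  refine eq_top_iff.2 fun w _ => ?_
  obtain ⟨t, rfl⟩ := Submodule.mkQ_surjective (inducedRelations R K V) w
  induction t with
  | zero => rw [map_zero]; exact N.zero_mem
  | tmul a v => rw [← smul_incl]; exact smul_mem_of_mem N a (h v)
  | add s t hs ht =>
    rw [map_add]
    exact N.add_mem (hs trivial) (ht trivial)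

/-- Over a field, a module embeds in its induced module. -/
theorem incl_injective {𝕜 L V : Type*} [Field 𝕜] [LieRing L] [LieAlgebra 𝕜 L]
    (K : LieSubalgebra 𝕜 L) [AddCommGroup V] [Module 𝕜 V] [LieRingModule K V]
    [LieModule 𝕜 K V] : Function.Injective (incl 𝕜 K V) := by
  obtain ⟨C, hC⟩ := Submodule.exists_isCompl K.toSubmodule
  let b := Module.Basis.ofVectorSpace 𝕜 C
  let e : L ≃ₗ[𝕜] K × (_ →₀ 𝕜) := (Submodule.prodEquivOfIsCompl _ C hC).symm ≪≫ₗ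
    (LinearEquiv.refl 𝕜 K.toSubmodule).prodCongr b.repr
  have he : ∀ κ : K, e κ = (κ, 0) := fun κ => by
    have : (Submodule.prodEquivOfIsCompl _ C hC).symm (κ : L) = (κ, 0) :=
      Submodule.prodEquivOfIsCompl_symm_apply_left _ _ hC κ
    simp [e, this]
  classical
  -- Any linear order serves; it only fixes the ordering of monomials.
  let _ : LinearOrder (Module.Basis.ofVectorSpaceIndex 𝕜 C) := linearOrderOfSTO WellOrderingRel
  refine (injective_iff_map_eq_zero _).2 fun v hv => ?_
  -- `comparison` vanishes on the relations but sends `1 ⊗ v` to `v` in degree zero.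
  have h := RelativePBW.comparison_eq_zero he ((Submodule.Quotient.mk_eq_zero _).1 hv)
  simpa [RelativePBW.comparison_tmul] using h

end

end InducedModule

/-! ### Weight filtrations generated by raising operators -/

namespace LadderSystem

noncomputable section

variable {𝕜 M ι : Type*} [Field 𝕜] [AddCommGroup M] [Module 𝕜 M]

/-- The filtration generated by a subspace `U` and operators `y i` of weight `wt i`: the `n`-th
step is spanned by the images of `U` under products of weight less than `n`. -/
def fil (U : Submodule 𝕜 M) (y : ι → Module.End 𝕜 M) (wt : ι → ℕ) (n : ℕ) : Submodule 𝕜 M :=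
  Submodule.span 𝕜 {x | ∃ l : List ι, ∃ u ∈ U, (l.map wt).sum < n ∧ x = (l.map y).prod u}

section fil

variable {U : Submodule 𝕜 M} {y : ι → Module.End 𝕜 M} {wt : ι → ℕ}

theorem prod_mem_fil {l : List ι} {n : ℕ} (hl : (l.map wt).sum < n) {u : M} (hu : u ∈ U) :
    (l.map y).prod u ∈ fil U y wt n :=
  Submodule.subset_span ⟨l, u, hu, hl, rfl⟩

theorem subset_fil_one {u : M} (hu : u ∈ U) : u ∈ fil U y wt 1 :=
  prod_mem_fil (l := []) (by simp) hu

theorem fil_mono {m n : ℕ} (h : m ≤ n) : fil U y wt m ≤ fil U y wt n :=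
  Submodule.span_mono fun _ ⟨l, u, hu, hl, hx⟩ => ⟨l, u, hu, hl.trans_le h, hx⟩

/-- The strict inequality in `fil` matters here: with truncated subtraction, membership in `fil U y
wt (n - s)` means vanishing as soon as `n ≤ s`. Lowering below the bottom gives zero without a
separate case. -/
theorem fil_zero : fil U y wt 0 = ⊥ := by simp [fil]

theorem map_mem_of_mem_fil {n : ℕ} {T : Module.End 𝕜 M} {S : Submodule 𝕜 M}
    (h : ∀ (l : List ι), ∀ u ∈ U, (l.map wt).sum < n → T ((l.map y).prod u) ∈ S) {x : M}
    (hx : x ∈ fil U y wt n) : T x ∈ S := by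
  have : fil U y wt n ≤ S.comap T := Submodule.span_le.2 fun x ⟨l, u, hu, hl, hx⟩ => by
    rw [hx]
    exact h l u hu hl
  exact this hx

theorem apply_mem_fil (j : ι) {n : ℕ} {x : M} (hx : x ∈ fil U y wt n) :
    y j x ∈ fil U y wt (n + wt j) :=
  map_mem_of_mem_fil (fun l u hu hl => prod_mem_fil (l := j :: l)
    (by rw [List.map_cons, List.sum_cons]; omega) hu) hx

theorem apply_mem_fil_sub (j : ι) {m k : ℕ} {x : M} (hx : x ∈ fil U y wt (m - k)) :
    y j x ∈ fil U y wt (m + wt j - k) := by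
  rcases le_total m k with h | h
  · rw [Nat.sub_eq_zero_of_le h, fil_zero, Submodule.mem_bot] at hx
    simp [hx]
  · have := apply_mem_fil j hx
    rwa [show m - k + wt j = m + wt j - k by omega] at this

theorem mem_iSup_fil {x : M} : x ∈ ⨆ n, fil U y wt n ↔ ∃ n, x ∈ fil U y wt n :=
  Submodule.mem_iSup_of_directed _
    (Monotone.directed_le fun _ _ => fil_mono (U := U) (y := y) (wt := wt))

/-- To bound the image of the filtration, it suffices to argue by induction on products. -/
theorem map_mem_fil_of_cons {κ : Type*} {T : κ → Module.End 𝕜 M} {s : κ → ℕ}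
    (base : ∀ i, ∀ u ∈ U, T i u ∈ fil U y wt (1 - s i))
    (step : ∀ j n, ∀ x ∈ fil U y wt n, (∀ i, T i x ∈ fil U y wt (n - s i)) →
      ∀ i, T i (y j x) ∈ fil U y wt (n + wt j - s i)) (i : κ) {n : ℕ} {x : M}
    (hx : x ∈ fil U y wt n) : T i x ∈ fil U y wt (n - s i) := by
  refine map_mem_of_mem_fil (fun l u hu hl => ?_) hx
  refine fil_mono (Nat.sub_le_sub_right (Nat.succ_le_of_lt hl) _) ?_
  clear hl
  induction l generalizing i with
  | nil => exact base i u hu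
  | cons j l ih =>
    have := step j _ _ (prod_mem_fil (Nat.lt_succ_self (l.map wt).sum) hu) ih i
    simp only [List.map_cons, List.prod_cons, List.sum_cons, Module.End.mul_apply]
    exact fil_mono (by omega) this

end fil

end

end LadderSystem

/-- Raising operators `y`, lowering operators `a` and an operator `g` on a vector space such that,
up to terms of lower weight, the `y i` commute with each other and with `g`, and
`[a i, y i] = c i • g`, `[a i, y j] = 0` for `j < i`, on the space generated by the action of the
raising operators on the subspace `U`. -/
structure LadderSystem (𝕜 M ι : Type*) [Field 𝕜] [AddCommGroup M] [Module 𝕜 M]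
    [LinearOrder ι] where
  U : Submodule 𝕜 M
  y : ι → Module.End 𝕜 M
  a : ι → Module.End 𝕜 M
  g : Module.End 𝕜 M
  wt : ι → ℕ
  c : ι → 𝕜
  wt_pos : ∀ i, 0 < wt i
  c_ne_zero : ∀ i, c i ≠ 0
  g_mem : ∀ u ∈ U, g u ∈ U
  g_ne_zero : ∀ u ∈ U, u ≠ 0 → g u ≠ 0
  a_mem : ∀ i n, ∀ x ∈ LadderSystem.fil U y wt n, a i x ∈ LadderSystem.fil U y wt (n - wt i)
  comm_y : ∀ i j n, ∀ x ∈ LadderSystem.fil U y wt n,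
    y i (y j x) - y j (y i x) ∈ LadderSystem.fil U y wt (n + wt j + wt i - 1)
  comm_g : ∀ j n, ∀ x ∈ LadderSystem.fil U y wt n,
    g (y j x) - y j (g x) ∈ LadderSystem.fil U y wt (n + wt j - 1)
  comm_a_of_lt : ∀ i j n, j < i → ∀ x ∈ LadderSystem.fil U y wt n,
    a i (y j x) - y j (a i x) ∈ LadderSystem.fil U y wt (n + wt j - wt i - 1)
  comm_a_self : ∀ i n, ∀ x ∈ LadderSystem.fil U y wt n,
    a i (y i x) - y i (a i x) - c i • g x ∈ LadderSystem.fil U y wt (n - 1)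

/-! ### Leading terms in a ladder system and the descent to the bottom subspace -/

namespace LadderSystem

noncomputable section

variable {𝕜 M ι : Type*} [Field 𝕜] [AddCommGroup M] [Module 𝕜 M] [LinearOrder ι]
  (S : LadderSystem 𝕜 M ι)

/-- The filtration attached to a ladder system. -/
abbrev filt (n : ℕ) : Submodule 𝕜 M := fil S.U S.y S.wt n

/-- The weight of a list of indices. -/
abbrev weight (l : List ι) : ℕ := (l.map S.wt).sum

/-- The ordered product of raising operators indexed by a list. -/
abbrev mon (l : List ι) : Module.End 𝕜 M := (l.map S.y).prod

variable {S}

theorem filt_zero : S.filt 0 = ⊥ := fil_zero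

theorem weight_perm {l l' : List ι} (h : l.Perm l') : S.weight l = S.weight l' :=
  (h.map S.wt).sum_eq

theorem mon_mem {l : List ι} {u : M} (hu : u ∈ S.U) : S.mon l u ∈ S.filt (S.weight l + 1) :=
  prod_mem_fil (Nat.lt_succ_self _) hu

theorem mon_cons (j : ι) (l : List ι) (u : M) : S.mon (j :: l) u = S.y j (S.mon l u) := by
  simp [mon]

theorem weight_cons (j : ι) (l : List ι) : S.weight (j :: l) = S.wt j + S.weight l := by
  simp [weight]

/-- Each transposition costs a commutator of lower weight. Leading terms can thus be indexed by
multisets. -/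
theorem mon_perm {l l' : List ι} (h : l.Perm l') {u : M} (hu : u ∈ S.U) :
    S.mon l u - S.mon l' u ∈ S.filt (S.weight l) := by
  induction h with
  | nil => simp
  | cons j _ ih =>
    rw [mon_cons, mon_cons, ← map_sub, weight_cons, add_comm]
    exact apply_mem_fil j ih
  | swap i j l =>
    have h := S.comm_y j i _ _ (mon_mem (l := l) hu)
    rw [mon_cons, mon_cons, mon_cons, mon_cons, weight_cons, weight_cons]
    exact fil_mono (by omega) h
  | trans h _ ih₁ ih₂ =>
    rw [← weight_perm h] at ih₂
    simpa using add_mem ih₁ ih₂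

theorem g_mon (l : List ι) {u : M} (hu : u ∈ S.U) :
    S.g (S.mon l u) - S.mon l (S.g u) ∈ S.filt (S.weight l) := by
  induction l with
  | nil =>
    rw [show S.g (S.mon [] u) - S.mon [] (S.g u) = 0 from sub_self (S.g u)]
    exact zero_mem _
  | cons j l ih =>
    have h1 := S.comm_g j _ _ (mon_mem (l := l) hu)
    have h2 := apply_mem_fil j ih
    rw [mon_cons, mon_cons, weight_cons]
    have := add_mem (fil_mono (n := S.wt j + S.weight l) (by omega) h1)
      (fil_mono (n := S.wt j + S.weight l) (by omega) h2)
    simpa using this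

/-- A lowering operator acts on products of raising operators of index at most its own as a
derivation, up to terms of lower weight. -/
theorem a_mon {N : ι} {l : List ι} (hl : ∀ j ∈ l, j ≤ N) {u : M} (hu : u ∈ S.U) :
    S.a N (S.mon l u) - ((l.count N : 𝕜) * S.c N) • S.mon (l.erase N) (S.g u) ∈
      S.filt (S.weight l - S.wt N) := by
  induction l with
  | nil =>
    have h := S.a_mem N _ _ (mon_mem (l := []) hu)
    have := S.wt_pos N
    have h0 : S.a N (S.mon [] u) ∈ S.filt 0 := fil_mono (by change 0 + 1 - S.wt N ≤ 0; omega) h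
    simpa [weight] using h0
  | cons j l ih =>
    have ih := ih fun i hi => hl i (by simp [hi])
    have hu' := mon_mem (l := l) hu
    rcases (hl j (by simp)).lt_or_eq with hj | rfl
    · have h1 := S.comm_a_of_lt N j _ hj _ hu'
      have h2 := apply_mem_fil_sub j ih
      rw [List.count_cons_of_ne hj.ne, List.erase_cons_tail (by simpa using hj.ne), mon_cons,
        mon_cons, weight_cons]
      have := add_mem (fil_mono (n := S.wt j + S.weight l - S.wt N) (by omega) h1)
        (fil_mono (n := S.wt j + S.weight l - S.wt N) (by omega) h2)
      rw [map_sub, map_smul] at this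
      convert this using 1
      abel
    · have h1 := S.comm_a_self j _ _ hu'
      have h2 := apply_mem_fil_sub j ih
      have h3 := Submodule.smul_mem _ (S.c j) (g_mon l hu)
      -- Putting the erased `j` back in front gives a permutation of `l`, hence the same monomial
      -- modulo lower weight. If `j` does not occur in `l`, the coefficient is zero.
      have h4 : ((l.count j : 𝕜) * S.c j) •
          (S.y j (S.mon (l.erase j) (S.g u)) - S.mon l (S.g u)) ∈ S.filt (S.weight l) := by
        by_cases hjl : j ∈ l
        · have hp := (List.perm_cons_erase hjl).symm
          have := mon_perm hp (S.g_mem u hu)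
          rw [mon_cons, weight_perm hp] at this
          exact Submodule.smul_mem _ _ this
        · simp [List.count_eq_zero.2 hjl]
      rw [List.count_cons_self, List.erase_cons_head, mon_cons, weight_cons,
        Nat.add_sub_cancel_left]
      have := add_mem (add_mem (add_mem (fil_mono (n := S.weight l) (by omega) h1)
        (fil_mono (n := S.weight l) (by omega) h2)) h3) h4
      rw [map_sub, map_smul] at this
      convert this using 1
      push_cast
      module

variable (S) in
/-- The value of a formal combination of monomials in the raising operators. -/
def eval : (Multiset ι →₀ S.U) →ₗ[𝕜] M :=
  Finsupp.lsum 𝕜 fun J => S.mon J.sort ∘ₗ S.U.subtype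

theorem eval_single (J : Multiset ι) (u : S.U) :
    S.eval (Finsupp.single J u) = S.mon J.sort u := by
  simp [eval]

theorem weight_sort_coe (l : List ι) : S.weight (l : Multiset ι).sort = S.weight l :=
  weight_perm (Multiset.coe_eq_coe.1 (Multiset.sort_eq _ _))

/-- The elements of the filtration have leading terms. -/
theorem exists_eval_add {n : ℕ} {x : M} (hx : x ∈ S.filt (n + 1)) :
    ∃ f : Multiset ι →₀ S.U, (∀ J ∈ f.support, S.weight J.sort = n) ∧
      x - S.eval f ∈ S.filt n := by
  classical
  induction hx using Submodule.span_induction with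
  | mem x hx =>
    obtain ⟨l, u, hu, hl, rfl⟩ := hx
    rcases (Nat.lt_succ_iff.1 hl).lt_or_eq with h | h
    · exact ⟨0, by simp, by simpa using prod_mem_fil h hu⟩
    · refine ⟨Finsupp.single l ⟨u, hu⟩, fun J hJ => ?_, ?_⟩
      · rw [Finset.mem_singleton.1 (Finsupp.support_single_subset hJ), weight_sort_coe, ← h]
      · rw [eval_single, ← h]
        exact mon_perm (Multiset.coe_eq_coe.1 (Multiset.sort_eq _ _).symm) hu
  | zero => exact ⟨0, by simp, by simp⟩
  | add x x' _ _ h h' =>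
    obtain ⟨f, hf, hx⟩ := h
    obtain ⟨f', hf', hx'⟩ := h'
    refine ⟨f + f', fun J hJ => ?_, ?_⟩
    · rcases Finset.mem_union.1 (Finsupp.support_add hJ) with h | h
      exacts [hf J h, hf' J h]
    · rw [map_add, add_sub_add_comm]
      exact add_mem hx hx'
  | smul r x _ h =>
    obtain ⟨f, hf, hx⟩ := h
    refine ⟨r • f, fun J hJ => hf J (Finsupp.support_smul hJ), ?_⟩
    rw [map_smul, ← smul_sub]
    exact Submodule.smul_mem _ _ hx

variable (S) in
/-- The restriction of `g` to `U`. -/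
def gRestrict : S.U →ₗ[𝕜] S.U := S.g.restrict S.g_mem

variable (S) in
/-- The formal derivation that models the lowering operator `a N`. -/
def deriv (N : ι) : (Multiset ι →₀ S.U) →ₗ[𝕜] (Multiset ι →₀ S.U) :=
  Finsupp.lsum 𝕜 fun J =>
    ((J.count N : 𝕜) * S.c N) • (Finsupp.lsingle (J.erase N) ∘ₗ S.gRestrict)

/-- Erasing `N` is injective on multisets containing `N`, and the others contribute with
multiplicity zero. So no cancellation occurs in the derivative. -/
theorem deriv_apply_erase {N : ι} {J : Multiset ι} (hJ : N ∈ J) (f : Multiset ι →₀ S.U) :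
    S.deriv N f (J.erase N) = ((J.count N : 𝕜) * S.c N) • S.gRestrict (f J) := by
  classical
  induction f using Finsupp.induction_linear with
  | zero => simp
  | add f g hf hg => simp [hf, hg]
  | single J' u =>
    simp only [deriv, Finsupp.lsum_single, LinearMap.smul_apply, LinearMap.comp_apply,
      Finsupp.lsingle_apply, Finsupp.smul_apply]
    by_cases h : J' = J
    · subst h; simp
    · rw [Finsupp.single_eq_of_ne (a := J') (Ne.symm h)]
      by_cases hN : N ∈ J'
      · rw [Finsupp.single_eq_of_ne]
        · simp
        · intro h'
          exact h (by rw [← Multiset.cons_erase hN, ← Multiset.cons_erase hJ, h'])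
      · simp [Multiset.count_eq_zero.2 hN]

theorem deriv_homogeneous {N : ι} {n : ℕ} {f : Multiset ι →₀ S.U}
    (hf : ∀ J ∈ f.support, S.weight J.sort = n) :
    ∀ J ∈ (S.deriv N f).support, S.weight J.sort = n - S.wt N := by
  classical
  intro J hJ
  rw [deriv, Finsupp.lsum_apply] at hJ
  obtain ⟨J', hJ', h⟩ := Finset.mem_biUnion.1 (Finsupp.support_sum hJ)
  by_cases hN : N ∈ J'
  · have h1 := Finset.mem_singleton.1 (Finsupp.support_single_subset (Finsupp.support_smul h))
    have h2 : J'.sort.Perm (N :: J.sort) := by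
      rw [← Multiset.coe_eq_coe, ← Multiset.cons_coe, Multiset.sort_eq, Multiset.sort_eq, h1,
        Multiset.cons_erase hN]
    have h3 := weight_perm (S := S) h2
    rw [hf J' hJ', weight_cons] at h3
    omega
  · simp [Multiset.count_eq_zero.2 hN] at h

theorem a_eval {N : ι} {n : ℕ} {f : Multiset ι →₀ S.U}
    (hf : ∀ J ∈ f.support, S.weight J.sort = n) (hN : ∀ J ∈ f.support, ∀ j ∈ J, j ≤ N) :
    S.a N (S.eval f) - S.eval (S.deriv N f) ∈ S.filt (n - S.wt N) := by
  have he : S.eval f = ∑ J ∈ f.support, S.mon J.sort (f J) := rfl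
  have hd : S.deriv N f = ∑ J ∈ f.support,
      ((J.count N : 𝕜) * S.c N) • Finsupp.single (J.erase N) (S.gRestrict (f J)) := rfl
  rw [he, hd, map_sum, map_sum, ← Finset.sum_sub_distrib]
  refine sum_mem fun J hJ => ?_
  have h1 := a_mon (l := J.sort) (N := N) (by simpa using hN J hJ) (f J).2
  rw [hf J hJ] at h1
  rw [map_smul, eval_single]
  by_cases hNJ : N ∈ J
  · have hp : (J.sort.erase N).Perm (J.erase N).sort := by
      rw [← Multiset.coe_eq_coe, ← Multiset.coe_erase, Multiset.sort_eq, Multiset.sort_eq]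
    have hw := weight_perm (S := S) (List.perm_cons_erase ((Multiset.mem_sort (· ≤ ·)).2 hNJ))
    rw [hf J hJ, weight_cons] at hw
    have h2 := mon_perm hp (S.g_mem _ (f J).2)
    have h3 := add_mem h1 (Submodule.smul_mem _ ((J.count N : 𝕜) * S.c N)
      (fil_mono (n := n - S.wt N) (by omega) h2))
    have hc : J.sort.count N = J.count N := by
      rw [← Multiset.coe_count, Multiset.sort_eq]
    rw [hc, smul_sub, sub_add_sub_cancel] at h3
    exact h3
  · have hc : J.sort.count N = 0 := List.count_eq_zero.2 (by simpa using hNJ)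
    rw [hc] at h1
    simpa [Multiset.count_eq_zero.2 hNJ] using h1

/-- The descent: differentiate the leading polynomial `f` in its largest variable and recurse on the
weight. The largest variable is required because `a N` is controlled only on monomials with indices
at most `N`. -/
theorem exists_mem_of_eval_add_mem [CharZero 𝕜] {W : Submodule 𝕜 M}
    (hW : ∀ i, ∀ x ∈ W, S.a i x ∈ W) {n : ℕ} {f : Multiset ι →₀ S.U}
    (hf : ∀ J ∈ f.support, S.weight J.sort = n) (hf0 : f ≠ 0) {w : M} (hw : w ∈ W)
    (hr : w - S.eval f ∈ S.filt n) : ∃ x ∈ W, x ∈ S.U ∧ x ≠ 0 := by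
  classical
  induction n using Nat.strong_induction_on generalizing f w with
  | _ n ih =>
  by_cases hE : (f.support.biUnion fun J => J.toFinset).Nonempty
  · obtain ⟨J₀, hJ₀, hN⟩ := Finset.mem_biUnion.1 (Finset.max'_mem _ hE)
    have hmax : ∀ J ∈ f.support, ∀ j ∈ J, j ≤ Finset.max' _ hE := fun J hJ j hj =>
      Finset.le_max' _ _ (Finset.mem_biUnion.2 ⟨J, hJ, Multiset.mem_toFinset.2 hj⟩)
    set N := Finset.max' _ hE
    rw [Multiset.mem_toFinset] at hN
    have hn : S.wt N ≤ n := by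
      have := weight_perm (S := S)
        (List.perm_cons_erase ((Multiset.mem_sort (s := J₀) (· ≤ ·)).2 hN))
      rw [hf J₀ hJ₀, weight_cons] at this
      omega
    have hpos := S.wt_pos N
    refine ih (n - S.wt N) (by omega) (f := S.deriv N f) (deriv_homogeneous hf) ?_ (hW N w hw) ?_
    · intro h0
      -- The coefficient at `J₀.erase N` survives: the multiplicity of `N` is nonzero in
      -- characteristic zero, `c N ≠ 0`, and `g` is injective on `U`.
      have h1 := deriv_apply_erase hN f
      rw [h0, Finsupp.zero_apply, eq_comm, smul_eq_zero, mul_eq_zero, Nat.cast_eq_zero,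
        Multiset.count_eq_zero] at h1
      rcases h1 with (h1 | h1) | h1
      · exact h1 hN
      · exact S.c_ne_zero N h1
      · exact S.g_ne_zero _ (f J₀).2 (by simpa using Finsupp.mem_support_iff.1 hJ₀)
          (congrArg Subtype.val h1)
    · have h1 := S.a_mem N _ _ hr
      have h2 := add_mem h1 (a_eval hf hmax)
      rwa [map_sub, sub_add_sub_cancel] at h2
  -- No variable occurs, so `f` is a constant of weight zero. The error term lies in `filt 0 = ⊥`,
  -- and `w` equals that constant exactly.
  · have hsupp : ∀ J ∈ f.support, J = 0 := fun J hJ => by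
      by_contra hJ0
      obtain ⟨j, hj⟩ := Multiset.exists_mem_of_ne_zero hJ0
      exact hE ⟨j, Finset.mem_biUnion.2 ⟨J, hJ, Multiset.mem_toFinset.2 hj⟩⟩
    obtain ⟨J, hJ⟩ := Finsupp.support_nonempty_iff.2 hf0
    obtain rfl := hsupp J hJ
    have hfs : f = Finsupp.single 0 (f 0) := by
      ext1 J
      by_cases hJ0 : J = 0
      · simp [hJ0]
      · rw [Finsupp.single_eq_of_ne hJ0]
        by_contra h
        exact hJ0 (hsupp J (Finsupp.mem_support_iff.2 h))
    have hn : n = 0 := by simpa [weight] using (hf 0 hJ).symm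
    have hev : S.eval f = f 0 := by
      rw [hfs, eval_single]
      simp [mon]
    rw [hn, filt_zero, Submodule.mem_bot, sub_eq_zero, hev] at hr
    exact ⟨w, hw, hr ▸ (f 0).2, hr ▸ by simpa using Finsupp.mem_support_iff.1 hJ⟩

/-- A nonzero subspace of the filtered part of a ladder system that is stable under the lowering
operators meets `U`. -/
theorem exists_mem_of_mem_filt [CharZero 𝕜] (S : LadderSystem 𝕜 M ι) {W : Submodule 𝕜 M}
    (hW : ∀ i, ∀ x ∈ W, S.a i x ∈ W) {n : ℕ} {w : M} (hw : w ∈ W) (hwn : w ∈ S.filt n)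
    (hw0 : w ≠ 0) : ∃ x ∈ W, x ∈ S.U ∧ x ≠ 0 := by
  induction n with
  | zero => exact absurd (by simpa [filt_zero] using hwn) hw0
  | succ n ih =>
    obtain ⟨f, hf, hr⟩ := exists_eval_add hwn
    rcases eq_or_ne f 0 with rfl | hf0
    · exact ih (by simpa using hr)
    · exact exists_mem_of_eval_add_mem hW hf hf0 hw hr

end

end LadderSystem

/-! ### Commutation relations of `𝓛` on a module -/

namespace DeformedHV

noncomputable section

set_option linter.unusedSectionVars false

open LadderSystem

section module

variable {M : Type*} [AddCommGroup M] [Module ℂ M] [LieRingModule DeformedHV M]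
  [LieModule ℂ DeformedHV M]

theorem lie_d_d (m n : ℤ) (x : M) : ⁅d m, ⁅d n, x⁆⁆ = ⁅d n, ⁅d m, x⁆⁆ +
    (((m : ℂ) - n) • ⁅d (m + n), x⁆ + ((m : ℂ) - n) • ⁅h (m + n), x⁆
      + (if m + n = 0 then ((m : ℂ) ^ 3 - m) / 12 else 0) • ⁅c, x⁆) := by
  rw [leibniz_lie, bracket_d_d, add_lie, add_lie, smul_lie, smul_lie, smul_lie, add_comm]

theorem lie_d_h (m n : ℤ) (x : M) :
    ⁅d m, ⁅h n, x⁆⁆ = ⁅h n, ⁅d m, x⁆⁆ + (-(n : ℂ)) • ⁅h (m + n), x⁆ := by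
  rw [leibniz_lie, bracket_d_h, smul_lie, add_comm]

theorem lie_h_d (m n : ℤ) (x : M) :
    ⁅h m, ⁅d n, x⁆⁆ = ⁅d n, ⁅h m, x⁆⁆ + (m : ℂ) • ⁅h (n + m), x⁆ := by
  rw [leibniz_lie, bracket_h_d, smul_lie, add_comm]

theorem lie_h_h (m n : ℤ) (x : M) : ⁅h m, ⁅h n, x⁆⁆ = ⁅h n, ⁅h m, x⁆⁆ := by
  rw [leibniz_lie, bracket_h_h, zero_lie, zero_add]

theorem lie_c_lie (y : DeformedHV) (x : M) : ⁅c, ⁅y, x⁆⁆ = ⁅y, ⁅c, x⁆⁆ := by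
  rw [leibniz_lie, bracket_def, bracketHom_c, zero_lie, zero_add]

theorem lie_mem_of_generators {S : Submodule ℂ M} {w : M} (hd : ∀ m, ⁅d m, w⁆ ∈ S)
    (hh : ∀ n, ⁅h n, w⁆ ∈ S) (hc : ⁅c, w⁆ ∈ S) (x : DeformedHV) : ⁅x, w⁆ ∈ S := by
  have hx : x ∈ Submodule.span ℂ (Set.range basis) := basis.mem_span x
  induction hx using Submodule.span_induction with
  | mem x hx =>
    obtain ⟨i, rfl⟩ := hx
    cases i
    exacts [hd _, hh _, hc]
  | zero => rw [zero_lie]; exact S.zero_mem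
  | add x y _ _ hx hy => rw [add_lie]; exact S.add_mem hx hy
  | smul r x _ hx => rw [smul_lie]; exact S.smul_mem r hx

/-- The operators `d_{-1}, d_{-2}, …`. -/
def lowerD (M : Type*) [AddCommGroup M] [Module ℂ M] [LieRingModule DeformedHV M]
    [LieModule ℂ DeformedHV M] (j : ℕ) : Module.End ℂ M :=
  LieModule.toEnd ℂ DeformedHV M (d (-(j + 1)))

theorem lowerD_apply (j : ℕ) (x : M) : lowerD M j x = ⁅d (-(j + 1)), x⁆ := rfl

/-! ### The ladder of the `d_{-j}` over a subspace stable under all `h_n` -/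

section D

variable {U : Submodule ℂ M}

local notation "F" => fil U (lowerD M) (fun _ => 1)

theorem d_neg_mem {m : ℤ} (hm : m < 0) {n : ℕ} {x : M} (hx : x ∈ F n) : ⁅d m, x⁆ ∈ F (n + 1) := by
  obtain ⟨j, rfl⟩ : ∃ j : ℕ, m = -(j + 1) := ⟨(-m - 1).toNat, by omega⟩
  exact apply_mem_fil j hx

variable (hU : ∀ n, ∀ x ∈ U, ⁅h n, x⁆ ∈ U)

include hU in
-- Passing `h_m` through a `d` yields a multiple of another `h`, so the induction runs over all `m`
-- at once.
theorem h_mem_filD (m : ℤ) {n : ℕ} {x : M} (hx : x ∈ F n) : ⁅h m, x⁆ ∈ F n := by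
  refine map_mem_fil_of_cons (T := fun m : ℤ => LieModule.toEnd ℂ DeformedHV M (h m))
    (s := fun _ => 0) (fun i u hu => subset_fil_one (hU i u hu))
    (fun j n x _ ih i => ?_) m hx
  simp only [LieModule.toEnd_apply_apply, lowerD_apply, Nat.sub_zero] at ih ⊢
  rw [lie_h_d]
  exact add_mem (apply_mem_fil j (ih i)) (Submodule.smul_mem _ _ (fil_mono (by simp) (ih _)))

theorem c_mem_filD (hcU : ∀ x ∈ U, ⁅c, x⁆ ∈ U) {n : ℕ} {x : M} (hx : x ∈ F n) :
    ⁅c, x⁆ ∈ F n := by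
  refine map_mem_fil_of_cons (T := fun _ : Unit => LieModule.toEnd ℂ DeformedHV M c)
    (s := fun _ => 0) (fun i u hu => subset_fil_one (hcU u hu))
    (fun j n x _ ih i => ?_) () hx
  simp only [LieModule.toEnd_apply_apply, lowerD_apply, Nat.sub_zero] at ih ⊢
  rw [lie_c_lie]
  exact apply_mem_fil j (ih i)

include hU in
theorem d_mem_filD (hdU : ∀ m : ℕ, ∀ x ∈ U, ⁅d m, x⁆ ∈ U) (hcU : ∀ x ∈ U, ⁅c, x⁆ ∈ U)
    (m : ℕ) {n : ℕ} {x : M} (hx : x ∈ F n) : ⁅d m, x⁆ ∈ F n := by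
  refine map_mem_fil_of_cons (T := fun m : ℕ => LieModule.toEnd ℂ DeformedHV M (d m))
    (s := fun _ => 0) (fun i u hu => subset_fil_one (hdU i u hu))
    (fun j n x hx ih i => ?_) m hx
  simp only [LieModule.toEnd_apply_apply, lowerD_apply, Nat.sub_zero] at ih ⊢
  rw [lie_d_d]
  have hle : F n ≤ F (n + 1) := fil_mono (Nat.le_succ n)
  refine add_mem (apply_mem_fil j (ih i)) (add_mem (add_mem (Submodule.smul_mem _ _ ?_)
    (Submodule.smul_mem _ _ (hle (h_mem_filD hU _ hx))))
    (Submodule.smul_mem _ _ (hle (c_mem_filD hcU hx))))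
  rcases lt_or_ge ((i : ℤ) + -(j + 1)) 0 with hlt | hge
  · exact d_neg_mem hlt hx
  · obtain ⟨p, hp⟩ := Int.eq_ofNat_of_zero_le hge
    rw [hp]
    exact hle (ih p)

include hU in
theorem lie_mem_iSup_filD (hdU : ∀ m : ℕ, ∀ x ∈ U, ⁅d m, x⁆ ∈ U)
    (hcU : ∀ x ∈ U, ⁅c, x⁆ ∈ U) (y : DeformedHV) {x : M} (hx : x ∈ ⨆ n, F n) :
    ⁅y, x⁆ ∈ ⨆ n, F n := by
  obtain ⟨n, hx⟩ := mem_iSup_fil.1 hx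
  refine lie_mem_of_generators (fun m => ?_) (fun m => ?_) ?_ y
  · rcases lt_or_ge m 0 with hlt | hge
    · exact mem_iSup_fil.2 ⟨_, d_neg_mem hlt hx⟩
    · obtain ⟨p, rfl⟩ := Int.eq_ofNat_of_zero_le hge
      exact mem_iSup_fil.2 ⟨_, d_mem_filD hU hdU hcU p hx⟩
  · exact mem_iSup_fil.2 ⟨_, h_mem_filD hU m hx⟩
  · exact mem_iSup_fil.2 ⟨_, c_mem_filD hcU hx⟩

variable {k : ℕ} (hkill : ∀ n : ℤ, k < n → ∀ x ∈ U, ⁅h n, x⁆ = 0)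

include hU hkill in
-- The commutator with a `d_{-j}` replaces that factor by a multiple of some `h`, which adds no
-- weight; one unit is lost. What reaches the bottom subspace is killed.
theorem h_mem_filD_sub (i : ℕ) {n : ℕ} {x : M} (hx : x ∈ F n) :
    ⁅h (k + (i + 1)), x⁆ ∈ F (n - 1) := by
  refine map_mem_fil_of_cons (T := fun i : ℕ => LieModule.toEnd ℂ DeformedHV M (h (k + (i + 1))))
    (s := fun _ => 1) (fun i u hu => ?_) (fun j n x hx ih i => ?_) i hx
  · rw [LieModule.toEnd_apply_apply, hkill _ (by omega) u hu]
    exact zero_mem _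
  · have := apply_mem_fil_sub j (ih i)
    simp only [LieModule.toEnd_apply_apply, lowerD_apply] at this ⊢
    rw [lie_h_d]
    exact add_mem this (Submodule.smul_mem _ _ (h_mem_filD hU _ hx))

/-- The ladder system of the `d_{-j}` and the `h_{k+j}`, for `j > 0`. -/
def ladderD (U : Submodule ℂ M) (k : ℕ) (hU : ∀ n, ∀ x ∈ U, ⁅h n, x⁆ ∈ U)
    (hkill : ∀ n : ℤ, k < n → ∀ x ∈ U, ⁅h n, x⁆ = 0)
    (hk : ∀ x ∈ U, x ≠ 0 → ⁅h k, x⁆ ≠ 0) : LadderSystem ℂ M ℕ where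
  U := U
  y := lowerD M
  a i := LieModule.toEnd ℂ DeformedHV M (h (k + (i + 1)))
  g := LieModule.toEnd ℂ DeformedHV M (h k)
  wt _ := 1
  c i := (k + (i + 1) : ℤ)
  wt_pos _ := one_pos
  c_ne_zero i := by rw [Int.cast_ne_zero]; omega
  g_mem := hU k
  g_ne_zero := hk
  a_mem i _ _ hx := h_mem_filD_sub hU hkill i hx
  -- A sum of two negative indices is nonzero, so no central term appears.
  comm_y i j n x hx := by
    rw [lowerD_apply, lowerD_apply, lowerD_apply, lowerD_apply, lie_d_d, add_sub_cancel_left,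
      if_neg (by omega), zero_smul, add_zero]
    exact add_mem (Submodule.smul_mem _ _ (d_neg_mem (by omega) hx))
      (Submodule.smul_mem _ _ (fil_mono (Nat.le_succ n) (h_mem_filD hU _ hx)))
  comm_g j n x hx := by
    rw [LieModule.toEnd_apply_apply, LieModule.toEnd_apply_apply, lowerD_apply, lowerD_apply,
      lie_h_d, add_sub_cancel_left]
    exact Submodule.smul_mem _ _ (h_mem_filD hU _ hx)
  -- For `j < i` the commutator is a multiple of `h_{k+(i-j)}`, itself a lowering operator.
  comm_a_of_lt i j n hji x hx := by
    rw [LieModule.toEnd_apply_apply, LieModule.toEnd_apply_apply, lowerD_apply, lowerD_apply,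
      lie_h_d, add_sub_cancel_left,
      show -((j : ℤ) + 1) + (k + (i + 1)) = k + (((i - j - 1 : ℕ) : ℤ) + 1) by omega]
    exact Submodule.smul_mem _ _ (h_mem_filD_sub hU hkill _ hx)
  comm_a_self i n x hx := by
    rw [LieModule.toEnd_apply_apply, LieModule.toEnd_apply_apply, LieModule.toEnd_apply_apply,
      lowerD_apply, lowerD_apply, lie_h_d, add_sub_cancel_left,
      show -((i : ℤ) + 1) + (k + (i + 1)) = k by ring, sub_self]
    exact zero_mem _

end D

/-! ### The ladder of the `h_{-q-j}` for finite `q` -/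

section H

variable {U : Submodule ℂ M}

/-- The operators `h_{-q-1}, h_{-q-2}, …`. -/
def lowerH (M : Type*) [AddCommGroup M] [Module ℂ M] [LieRingModule DeformedHV M]
    [LieModule ℂ DeformedHV M] (q j : ℕ) : Module.End ℂ M :=
  LieModule.toEnd ℂ DeformedHV M (h (-(q + (j + 1))))

theorem lowerH_apply (q j : ℕ) (x : M) : lowerH M q j x = ⁅h (-(q + (j + 1))), x⁆ := rfl

variable {q k : ℕ}

local notation "F" => fil U (lowerH M q) Nat.succ

theorem h_neg_mem {m : ℤ} {p : ℕ} (hp : -(q + p : ℤ) ≤ m) (hm : m < -q) {n : ℕ} {x : M}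
    (hx : x ∈ F n) : ⁅h m, x⁆ ∈ F (n + p) := by
  obtain ⟨j, rfl⟩ : ∃ j : ℕ, m = -(q + (j + 1)) := ⟨(-q - m - 1).toNat, by omega⟩
  exact fil_mono (by omega) (apply_mem_fil j hx)

variable (hU : ∀ m : ℤ, -(q : ℤ) ≤ m → ∀ x ∈ U, ⁅h m, x⁆ ∈ U)

include hU in
theorem h_mem_filH {m : ℤ} {p : ℕ} (hp : -(q + p : ℤ) ≤ m) {n : ℕ} {x : M}
    (hx : x ∈ F n) : ⁅h m, x⁆ ∈ F (n + p) := by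
  rcases lt_or_ge m (-q) with hlt | hge
  · exact h_neg_mem hp hlt hx
  · refine fil_mono (Nat.le_add_right n p) ?_
    refine map_mem_fil_of_cons (T := fun _ : Unit => LieModule.toEnd ℂ DeformedHV M (h m))
      (s := fun _ => 0) (fun i u hu => subset_fil_one (hU m hge u hu))
      (fun j n x _ ih i => ?_) () hx
    simp only [LieModule.toEnd_apply_apply, lowerH_apply, Nat.sub_zero] at ih ⊢
    rw [lie_h_h]
    exact apply_mem_fil j (ih i)

variable (hkill : ∀ n : ℤ, k < n → ∀ x ∈ U, ⁅h n, x⁆ = 0)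

include hkill in
-- The `h_n` commute, so `h_m` passes down to `U`, which it kills. The family and the weights are
-- arbitrary so as to cover both the filtration of this ladder and `hSpan`.
theorem h_lie_eq_zero {ι : Type*} {s : ι → ℤ} {wt : ι → ℕ} {m : ℤ} (hm : k < m) {n : ℕ} {x : M}
    (hx : x ∈ fil U (fun i => LieModule.toEnd ℂ DeformedHV M (h (s i))) wt n) :
    ⁅h m, x⁆ = 0 := by
  refine map_mem_of_mem_fil (T := LieModule.toEnd ℂ DeformedHV M (h m)) (S := ⊥)
    (fun l u hu hl => ?_) hx
  clear hl
  rw [Submodule.mem_bot]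
  induction l with
  | nil => exact hkill m hm u hu
  | cons j l ih =>
    rw [LieModule.toEnd_apply_apply] at ih
    rw [List.map_cons, List.prod_cons, Module.End.mul_apply, LieModule.toEnd_apply_apply,
      LieModule.toEnd_apply_apply, lie_h_h, ih, lie_zero]

variable (hdkill : ∀ m : ℤ, k + q < m → ∀ x ∈ U, ⁅d m, x⁆ = 0)

include hU hkill hdkill in
theorem d_mem_filH_sub (i : ℕ) {n : ℕ} {x : M} (hx : x ∈ F n) :
    ⁅d (k + q + (i + 1)), x⁆ ∈ F (n - (i + 1)) := by
  refine map_mem_fil_of_cons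
    (T := fun i : ℕ => LieModule.toEnd ℂ DeformedHV M (d (k + q + (i + 1))))
    (s := Nat.succ) (fun i u hu => ?_) (fun j n x hx ih i => ?_) i hx
  · rw [LieModule.toEnd_apply_apply, hdkill _ (by omega) u hu]
    exact zero_mem _
  · have := apply_mem_fil_sub j (ih i)
    simp only [LieModule.toEnd_apply_apply, lowerH_apply] at this ⊢
    rw [lie_d_h]
    refine add_mem this (Submodule.smul_mem _ _ ?_)
    -- The commutator is a multiple of `h_{k+i-j}`. For `j < i` its index exceeds `k` and it
    -- vanishes; for `j ≥ i` it raises the weight by at most `j - i`. This is why the weight of the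
    -- `i`-th operator is `i + 1` and not `1`.
    rcases lt_or_ge j i with hlt | hge
    · rw [h_lie_eq_zero hkill (by omega) hx]
      exact zero_mem _
    · exact fil_mono (by omega) (h_mem_filH hU (p := j - i) (by omega) hx)

/-- The ladder system of the `h_{-q-j}` and the `d_{k+q+j}`, for `j > 0`. -/
def ladderH (U : Submodule ℂ M) (q k : ℕ) (hU : ∀ m : ℤ, -(q : ℤ) ≤ m → ∀ x ∈ U, ⁅h m, x⁆ ∈ U)
    (hkill : ∀ n : ℤ, k < n → ∀ x ∈ U, ⁅h n, x⁆ = 0)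
    (hdkill : ∀ m : ℤ, k + q < m → ∀ x ∈ U, ⁅d m, x⁆ = 0)
    (hk : ∀ x ∈ U, x ≠ 0 → ⁅h k, x⁆ ≠ 0) : LadderSystem ℂ M ℕ where
  U := U
  y := lowerH M q
  a i := LieModule.toEnd ℂ DeformedHV M (d (k + q + (i + 1)))
  g := LieModule.toEnd ℂ DeformedHV M (h k)
  wt := Nat.succ
  c i := -(-(q + (i + 1)) : ℤ)
  wt_pos := Nat.succ_pos
  c_ne_zero i := by rw [neg_ne_zero, Int.cast_ne_zero]; omega
  g_mem := hU k (by omega)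
  g_ne_zero := hk
  a_mem i _ _ hx := d_mem_filH_sub hU hkill hdkill i hx
  comm_y i j n x hx := by
    rw [lowerH_apply, lowerH_apply, lowerH_apply, lowerH_apply, lie_h_h, sub_self]
    exact zero_mem _
  comm_g j n x hx := by
    rw [LieModule.toEnd_apply_apply, LieModule.toEnd_apply_apply, lowerH_apply, lowerH_apply,
      lie_h_h, sub_self]
    exact zero_mem _
  comm_a_of_lt i j n hji x hx := by
    rw [LieModule.toEnd_apply_apply, LieModule.toEnd_apply_apply, lowerH_apply, lowerH_apply,
      lie_d_h, add_sub_cancel_left, h_lie_eq_zero hkill (by omega) hx, smul_zero]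
    exact zero_mem _
  comm_a_self i n x hx := by
    rw [LieModule.toEnd_apply_apply, LieModule.toEnd_apply_apply, LieModule.toEnd_apply_apply,
      lowerH_apply, lowerH_apply, lie_d_h, add_sub_cancel_left,
      show (k : ℤ) + q + (i + 1) + -(q + (i + 1)) = k by ring, sub_self]
    exact zero_mem _

end H

/-! ### The subspace generated by all `h_n` -/

section hSpan

/-- The subspace generated by a subspace under the action of all the `h_n`. -/
def hSpan (U : Submodule ℂ M) : Submodule ℂ M :=
  fil U (fun n : ℤ => LieModule.toEnd ℂ DeformedHV M (h n)) 0 1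

variable {U : Submodule ℂ M}

theorem le_hSpan : U ≤ hSpan U := fun _ hu => subset_fil_one hu

theorem h_mem_hSpan (n : ℤ) {x : M} (hx : x ∈ hSpan U) : ⁅h n, x⁆ ∈ hSpan U :=
  apply_mem_fil n hx

theorem hSpan_le {S : Submodule ℂ M} (hUS : U ≤ S) (hS : ∀ n, ∀ x ∈ S, ⁅h n, x⁆ ∈ S) :
    hSpan U ≤ S := fun x hx => by
  refine map_mem_of_mem_fil (T := LinearMap.id) (fun l u hu hl => ?_) hx
  clear hl
  induction l with
  | nil => exact hUS hu
  | cons n l ih => exact hS n _ ih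

theorem d_mem_hSpan (hdU : ∀ m : ℕ, ∀ x ∈ U, ⁅d m, x⁆ ∈ U) (m : ℕ) {x : M} (hx : x ∈ hSpan U) :
    ⁅d m, x⁆ ∈ hSpan U := by
  have hle : hSpan U ≤ hSpan U ⊓ (hSpan U).comap (LieModule.toEnd ℂ DeformedHV M (d m)) := by
    refine hSpan_le (fun u hu => ⟨le_hSpan hu, le_hSpan (hdU m u hu)⟩) fun n x hx => ?_
    refine ⟨h_mem_hSpan n hx.1, ?_⟩
    rw [SetLike.mem_coe, Submodule.mem_comap, LieModule.toEnd_apply_apply, lie_d_h]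
    exact add_mem (h_mem_hSpan _ hx.2) (Submodule.smul_mem _ _ (h_mem_hSpan _ hx.1))
  exact (hle hx).2

theorem c_mem_hSpan (hcU : ∀ x ∈ U, ⁅c, x⁆ ∈ U) {x : M} (hx : x ∈ hSpan U) :
    ⁅c, x⁆ ∈ hSpan U := by
  have hle : hSpan U ≤ (hSpan U).comap (LieModule.toEnd ℂ DeformedHV M c) := by
    refine hSpan_le (fun u hu => le_hSpan (hcU u hu)) fun n x hx => ?_
    rw [Submodule.mem_comap, LieModule.toEnd_apply_apply, lie_c_lie]
    exact h_mem_hSpan _ hx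
  exact hle hx

end hSpan

end module

end

end DeformedHV

/-! ### Injectivity of `h_k` and the second descent in the induced module -/

namespace DeformedHV

noncomputable section

open LadderSystem

section induced

variable {q : ℕ∞} {V : Type*} [AddCommGroup V] [Module ℂ V]
    [LieRingModule (positivePart q) V] [LieModule ℂ (positivePart q) V]

local notation "Ind" => InducedModule ℂ (positivePart q) V
local notation "incl" => InducedModule.incl ℂ (positivePart q) V
local notation "U" => LinearMap.range (InducedModule.incl ℂ (positivePart q) V)

theorem lie_mem_range_incl {x : DeformedHV} (hx : x ∈ Submodule.span ℂ (positiveGens q)) {u : Ind}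
    (hu : u ∈ U) : ⁅x, u⁆ ∈ U := by
  obtain ⟨v, rfl⟩ := hu
  exact ⟨⁅(⟨x, hx⟩ : positivePart q), v⁆, InducedModule.incl_lie _ _⟩

variable {k : ℕ}

theorem h_lie_incl_eq_zero (hh : ∀ n : ℕ, k < n → ∀ v : V, ⁅posH q n, v⁆ = 0) (n : ℤ)
    (hn : k < n) {u : Ind} (hu : u ∈ U) : ⁅h n, u⁆ = 0 := by
  obtain ⟨v, rfl⟩ := hu
  lift n to ℕ using by omega
  have h1 := InducedModule.incl_lie (posH q n) v
  rw [hh n (by omega), map_zero] at h1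
  exact h1.symm

theorem d_lie_incl_eq_zero (hd : ∀ m : ℕ, (k : ℕ∞) + q < (m : ℕ∞) → ∀ v : V, ⁅posD q m, v⁆ = 0)
    (m : ℕ) (hm : (k : ℕ∞) + q < m) {u : Ind} (hu : u ∈ U) : ⁅d m, u⁆ = 0 := by
  obtain ⟨v, rfl⟩ := hu
  have h1 := InducedModule.incl_lie (posD q m) v
  rw [hd m hm, map_zero] at h1
  exact h1.symm

/-- On a simple module, `h_k` acts injectively. -/
theorem h_lie_incl_ne_zero (hV : LieModule.IsIrreducible ℂ (positivePart q) V)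
    (hk : ∃ v : V, ⁅posH q k, v⁆ ≠ 0) (hh : ∀ n : ℕ, k < n → ∀ v : V, ⁅posH q n, v⁆ = 0)
    {u : Ind} (hu : u ∈ U) (hu0 : u ≠ 0) : ⁅h k, u⁆ ≠ 0 := by
  -- The kernel of `h_k` is stable: `[h_k, d_i] = k h_{k+i}` kills `U` for `i > 0` and is a multiple
  -- of `h_k` for `i = 0`.
  have key : ∀ x ∈ Submodule.span ℂ (positiveGens q), ∀ u ∈ U, ⁅h k, u⁆ = 0 →
      ⁅h k, ⁅x, u⁆⁆ = 0 := by
    intro x hx u hu hu0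
    induction hx using Submodule.span_induction with
    | mem x hx =>
      rcases hx with ⟨i, rfl⟩ | ⟨j, -, rfl⟩ | rfl
      · rw [lie_h_d, hu0, lie_zero, zero_add]
        rcases Nat.eq_zero_or_pos i with rfl | hi
        · simp [hu0]
        · rw [h_lie_incl_eq_zero hh _ (by omega) hu, smul_zero]
      · rw [lie_h_h, hu0, lie_zero]
      · rw [← lie_c_lie, hu0, lie_zero]
    | zero => simp
    | add x y _ _ hx hy => rw [add_lie, lie_add, hx, hy, add_zero]
    | smul r x _ hx => rw [smul_lie, lie_smul, hx, smul_zero]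
  let N : LieSubmodule ℂ (positivePart q) V :=
    { LinearMap.ker (LieModule.toEnd ℂ DeformedHV Ind (h k) ∘ₗ incl) with
      lie_mem := fun {κ v} hv => by
        change ⁅h k, incl ⁅κ, v⁆⁆ = 0
        rw [InducedModule.incl_lie]
        exact key κ κ.2 _ ⟨v, rfl⟩ hv }
  have hN : N = ⊥ := by
    refine (IsSimpleOrder.eq_bot_or_eq_top N).resolve_right fun htop => ?_
    obtain ⟨v, hv⟩ := hk
    have hvN : v ∈ N := htop ▸ LieSubmodule.mem_top v
    have h1 : ⁅h k, incl v⁆ = 0 := hvN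
    have h2 : incl ⁅posH q k, v⁆ = ⁅h k, incl v⁆ := InducedModule.incl_lie _ _
    rw [h1] at h2
    exact hv (InducedModule.incl_injective (positivePart q) (by rw [h2, map_zero]))
  obtain ⟨v, rfl⟩ := hu
  intro h0
  have hvN : v ∈ N := h0
  rw [hN, LieSubmodule.mem_bot] at hvN
  exact hu0 (by rw [hvN, map_zero])

/-- A nonzero subspace of the span of the `h_n`-translates of `V` meets `V` if it is stable under
the operators `d_m` that annihilate `V`. -/
theorem exists_mem_range_incl_of_mem_hSpan (hV : LieModule.IsIrreducible ℂ (positivePart q) V)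
    (hk : ∃ v : V, ⁅posH q k, v⁆ ≠ 0)
    (hd : ∀ m : ℕ, (k : ℕ∞) + q < (m : ℕ∞) → ∀ v : V, ⁅posD q m, v⁆ = 0)
    (hh : ∀ n : ℕ, k < n → ∀ v : V, ⁅posH q n, v⁆ = 0) {W : Submodule ℂ Ind}
    (hW : ∀ m : ℕ, (k : ℕ∞) + q < (m : ℕ∞) → ∀ x ∈ W, ⁅d m, x⁆ ∈ W) {w : Ind} (hw : w ∈ W)
    (hw' : w ∈ hSpan U) (hw0 : w ≠ 0) : ∃ x ∈ W, x ∈ U ∧ x ≠ 0 := by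
  rcases eq_or_ne q ⊤ with hq | hq
  -- For `q = ∞` every `h_n` belongs to `𝓛_q`, so `hSpan U` is `U`.
  · exact ⟨w, hw, hSpan_le le_rfl
      (fun n x hx => lie_mem_range_incl (h_mem_span _ (hq ▸ le_top)) hx) hw', hw0⟩
  obtain ⟨p, hp⟩ := ENat.ne_top_iff_exists.1 hq
  have hU : ∀ m : ℤ, -(p : ℤ) ≤ m → ∀ x ∈ U, ⁅h m, x⁆ ∈ U := fun m hm x hx =>
    lie_mem_range_incl (h_mem_span _ (by rw [← hp]; norm_cast; omega)) hx
  let S := ladderH U p k hU (fun n hn u hu => h_lie_incl_eq_zero hh n hn hu)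
    (fun m hm u hu => by
      lift m to ℕ using by omega
      exact d_lie_incl_eq_zero hd m (by rw [← hp]; norm_cast at hm ⊢) hu)
    (fun u hu hu0 => h_lie_incl_ne_zero hV hk hh hu hu0)
  have hle : hSpan U ≤ ⨆ n, S.filt n := by
    refine hSpan_le (fun u hu => mem_iSup_fil.2 ⟨1, subset_fil_one hu⟩) fun n x hx => ?_
    obtain ⟨m, hx⟩ := mem_iSup_fil.1 hx
    exact mem_iSup_fil.2 ⟨_, h_mem_filH hU (p := (-n).toNat) (by omega) hx⟩
  obtain ⟨n, hn⟩ := mem_iSup_fil.1 (hle hw')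
  refine S.exists_mem_of_mem_filt (fun i x hx => ?_) hw hn hw0
  have h1 := hW (k + p + (i + 1)) (by rw [← hp]; norm_cast; omega) x hx
  push_cast at h1
  exact h1

/-- The kernel of `h_k` in `hSpan U` is stable under `d_m` for `m > k + q`, since `[h_k, d_m] = k
h_{k+m}` vanishes there. If nonzero it would meet `U`, where `h_k` is injective. -/
theorem h_lie_ne_zero_of_mem_hSpan (hV : LieModule.IsIrreducible ℂ (positivePart q) V)
    (hk : ∃ v : V, ⁅posH q k, v⁆ ≠ 0)
    (hd : ∀ m : ℕ, (k : ℕ∞) + q < (m : ℕ∞) → ∀ v : V, ⁅posD q m, v⁆ = 0)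
    (hh : ∀ n : ℕ, k < n → ∀ v : V, ⁅posH q n, v⁆ = 0) {x : Ind} (hx : x ∈ hSpan U)
    (hx0 : x ≠ 0) : ⁅h k, x⁆ ≠ 0 := by
  intro h0
  have hdU : ∀ m : ℕ, ∀ u ∈ U, ⁅d m, u⁆ ∈ U := fun m u hu =>
    lie_mem_range_incl (d_mem_span q (by omega)) hu
  obtain ⟨u, hu, huU, hu0⟩ := exists_mem_range_incl_of_mem_hSpan hV hk hd hh
    (W := LinearMap.ker (LieModule.toEnd ℂ DeformedHV Ind (h k)) ⊓ hSpan U)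
    (fun m hm x hx => by
      refine ⟨?_, d_mem_hSpan hdU m hx.2⟩
      have hkm : k < m := by exact_mod_cast lt_of_le_of_lt le_self_add hm
      have h1 : ⁅h k, x⁆ = 0 := hx.1
      change ⁅h k, ⁅d m, x⁆⁆ = 0
      rw [lie_h_d, h1, lie_zero, zero_add,
        h_lie_eq_zero (fun n hn u hu => h_lie_incl_eq_zero hh n hn hu) (by omega) hx.2,
        smul_zero])
    ⟨h0, hx⟩ hx hx0
  exact h_lie_incl_ne_zero hV hk hh huU hu0 hu.1

end induced

end

end DeformedHV

/-! ### Simplicity of the induced module -/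

open DeformedHV in
theorem theorem3p3 (q : ℕ∞) (V : Type*) [AddCommGroup V] [Module ℂ V]
    [LieRingModule (DeformedHV.positivePart q) V] [LieModule ℂ (DeformedHV.positivePart q) V]
    (hV : LieModule.IsIrreducible ℂ (DeformedHV.positivePart q) V)
    (k : ℕ)
    (hk : ∃ v : V, ⁅DeformedHV.posH q k, v⁆ ≠ 0)
    (hd : ∀ m : ℕ, (k : ℕ∞) + q < (m : ℕ∞) → ∀ v : V, ⁅DeformedHV.posD q m, v⁆ = 0)
    (hh : ∀ n : ℕ, k < n → ∀ v : V, ⁅DeformedHV.posH q n, v⁆ = 0) :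
    LieModule.IsIrreducible ℂ DeformedHV
      (InducedModule ℂ (DeformedHV.positivePart q) V) := by
  have := hV
  set U := LinearMap.range (InducedModule.incl ℂ (positivePart q) V) with hUdef
  have hinj := InducedModule.incl_injective (V := V) (positivePart q)
  have hdU : ∀ m : ℕ, ∀ u ∈ U, ⁅d m, u⁆ ∈ U := fun m u hu =>
    lie_mem_range_incl (d_mem_span q (by omega)) hu
  have hcU : ∀ u ∈ U, ⁅c, u⁆ ∈ U := fun u hu => lie_mem_range_incl (c_mem_span q) hu
  have hS : ∀ n, ∀ x ∈ hSpan U, ⁅h n, x⁆ ∈ hSpan U := fun n x hx => h_mem_hSpan n hx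
  let S := ladderD (hSpan U) k hS
    (fun n hn x hx => h_lie_eq_zero (fun n hn u hu => h_lie_incl_eq_zero hh n hn hu) hn hx)
    (fun x hx hx0 => h_lie_ne_zero_of_mem_hSpan hV hk hd hh hx hx0)
  -- The union of the filtration is an `𝓛`-submodule containing `U`, hence everything.
  have htop : ∀ w : InducedModule ℂ (positivePart q) V, ∃ n, w ∈ S.filt n := by
    let N : LieSubmodule ℂ DeformedHV (InducedModule ℂ (positivePart q) V) :=
      { (⨆ n, S.filt n : Submodule ℂ _) with
        lie_mem := fun {y x} hx => lie_mem_iSup_filD hS (fun m x hx => d_mem_hSpan hdU m hx)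
          (fun x hx => c_mem_hSpan hcU hx) y hx }
    have hN : N = ⊤ := InducedModule.eq_top_of_incl_mem fun v =>
      LadderSystem.mem_iSup_fil.2 ⟨1, LadderSystem.subset_fil_one (le_hSpan ⟨v, rfl⟩)⟩
    intro w
    have hw : w ∈ N := hN ▸ LieSubmodule.mem_top w
    exact LadderSystem.mem_iSup_fil.1 hw
  have : Nontrivial V := by
    obtain ⟨v, hv⟩ := hk
    exact ⟨_, _, hv⟩
  have : Nontrivial (InducedModule ℂ (positivePart q) V) := hinj.nontrivial
  refine LieModule.IsIrreducible.mk fun N hN => ?_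
  obtain ⟨w, hw, hw0⟩ := (Submodule.ne_bot_iff N.toSubmodule).1 (by simpa using hN)
  obtain ⟨n, hn⟩ := htop w
  -- The first descent reaches `hSpan U`; the next one goes on to `U`.
  obtain ⟨x, hx, hxU, hx0⟩ := S.exists_mem_of_mem_filt (W := N.toSubmodule)
    (fun i x hx => N.lie_mem hx) hw hn hw0
  obtain ⟨_, hu, ⟨v, rfl⟩, hv0⟩ := exists_mem_range_incl_of_mem_hSpan hV hk hd hh
    (W := N.toSubmodule) (fun m _ x hx => N.lie_mem hx) hx hxU hx0
  let P : LieSubmodule ℂ (positivePart q) V :=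
    { N.toSubmodule.comap (InducedModule.incl ℂ (positivePart q) V) with
      lie_mem := fun {κ v} hv => by
        change InducedModule.incl ℂ (positivePart q) V ⁅κ, v⁆ ∈ N
        rw [InducedModule.incl_lie]
        exact N.lie_mem hv }
  have hP : P = ⊤ := by
    refine (IsSimpleOrder.eq_bot_or_eq_top P).resolve_left fun hbot => ?_
    have hvP : v ∈ P := hu
    rw [hbot, LieSubmodule.mem_bot] at hvP
    exact hv0 (by rw [hvP, map_zero])
  exact InducedModule.eq_top_of_incl_mem fun v => by
    have hv : v ∈ P := hP ▸ LieSubmodule.mem_top v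
    exact hv
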